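/- **Model.** Let $M=2^n$ with $n\ge 1$, and consider the complete binary tree whose leaves (level $0$) are $M$ processes, exactly one of which is anomalous (the target); the root is on level $n=\log_2 M$. At each time a search strategy probes one node and receives one observation. Observations are independent; an observation of a level-$l$ node has distribution $g_l$ if the target lies below (or at) that node and $f_l$ otherwise. Here $f_l=\mathrm{Bernoulli}(\mu_l)$ and $g_l=\mathrm{Bernoulli}(1-\mu_l)$ with $$\mu_l=\tfrac12-\left(\tfrac12-\mu_0\right)\alpha^{-l}\quad(l=0,1,2,\dots),\qquad \alpha>1,\quad 0<\mu_0<\tfrac12 .$$ Let $\pi$ be a prior on the position of the target, $\tau$ the number of observations taken, and $c\in(0,1)$ the cost per observation. For a strategy $\Gamma$ put $P_e(\Gamma)=\sum_m\pi_m\mathbb P[\text{the declared leaf is not } m\mid H_m]$, $Q(\Gamma)=\sum_m\pi_m\mathbb E[\tau\mid H_m]$ and $R(\Gamma)=P_e(\Gamma)+c\,Q(\Gamma)$, where $H_m$ is the hypothesis that leaf $m$ is the target. **Policy.** The information-directed random walk $\Gamma_{\mathrm{IRW}}$ starts at the root. At a node of level $l\ge1$ it takes $K_l$ samples from each of the two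 children and computes for each child the sum of log-likelihood ratios $\sum_k\log\frac{g_{l-1}(y_k)}{f_{l-1}(y_k)}$; if both sums are negative it moves to the parent (the parent of the root is the root), otherwise it moves to the child with the larger sum (equal sums being resolved by an arbitrary fixed rule). At a leaf it takes samples one by one and updates the sum $S$ of $\log\frac{g_0(y)}{f_0(y)}$ over the current visit; it moves back to the parent when $S<0$, and it stops and declares this leaf to be the target when $S>\log\frac{\log_2M}{c}$. For $Y_k\sim g_{l-1}$ and $Z_k\sim f_{l-1}$ ($1\le k\le K_l$), all independent, let $$p_l^{(g)}=\Pr\Big[\sum_{k}\log\tfrac{g_{l-1}(Y_k)}{f_{l-1}(Y_k)}>\max\Big\{\sum_{k}\log\tfrac{g_{l-1}(Z_k)}{f_{l-1}(Z_k)},0\Big\}\Big],\qquad p_l^{(f)}=\Pr\Big[\sum_{k}\log\tfrac{g_{l-1}(Z_k)}{f_{l-1}(Z_k)}<0\Big]^2 .$$ The sample sizes $(K_l)_{l\ge1}$ are chosen in one of two ways: either $K_l$ is the smallest integer with $p_l^{(g)}>p$ and $p_l^{(f)}>p$, for a fixed $p\in(\tfrac12,1)$; or $K_l=\left\lceil\frac{12(1-\mu_{l-1})\log\frac1{1-\eta}}{(1-2\mu_{l-1})^2}\right\rceil$,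 for a fixed $\eta\in(\tfrac1{\sqrt2},1)$. **Theorem.** With either choice of the sample sizes: 1. There is $p>\frac12$ such that $p_l^{(g)}>p$ and $p_l^{(f)}>p$ for all $l\ge1$. 2. There are constants $\tilde B$ and $C$, independent of $c$, $M$, $\pi$ and the tie-breaking rule, such that for all $n\ge1$, $M=2^n$, and all $c\in(0,1)$, $$R(\Gamma_{\mathrm{IRW}})\le c\,\tilde B\,M^{\log_2\alpha^2}+\frac{c\log\frac{\log_2M}{c}}{D(g_0\|f_0)}+C\,c ,$$ where $D(g_0\|f_0)$ is the Kullback–Leibler divergence. 3. For every fixed $c\in(0,1)$, $Q(\Gamma_{\mathrm{IRW}})=O\big(M^{\log_2\alpha^2}\big)$ as $M=2^n\to\infty$. In particular, if $1<\alpha<\sqrt2$, then $Q(\Gamma_{\mathrm{IRW}})/M\to0$, i.e. the sample complexity is sublinear in $M$. -/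

import Mathlib

/-! ### Searching a complete binary tree with `2 ^ n` leaves, one of which is the target -/

namespace TreeSearch

open MeasureTheory ProbabilityTheory
open scoped ENNReal BigOperators

/-- A node `(l, i)` of the complete binary tree with leaves `0, 1, …, 2 ^ n - 1`: the `i`-th node on
level `l`, aggregating the leaves `i * 2 ^ l, …, (i + 1) * 2 ^ l - 1`. The leaves are the nodes
`(0, m)`, the root is `(n, 0)`, and the children of `(l + 1, i)` are `(l, 2 * i)` (left) and
`(l, 2 * i + 1)` (right). -/
abbrev Node : Type := ℕ × ℕ

/-- The parent of a node in the tree of height `n`; the parent of the root is the root itself. -/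
def parent (n : ℕ) (v : Node) : Node :=
  if v.1 = n then v else (v.1 + 1, v.2 / 2)

/-- Leaf `m` lies below the node `v`. -/
def Contains (v : Node) (m : ℕ) : Prop := m / 2 ^ v.1 = v.2

/-- An active search strategy. The observation history is a list, most recent observation first;
since the strategy is deterministic, the history also determines the nodes probed so far. -/
structure Strategy where
  /-- the node probed next -/
  select : List Bool → Node
  /-- whether to terminate the search -/
  halt : List Bool → Prop
  /-- the leaf declared to be the target upon stopping -/
  declare : List Bool → ℕ

/-- Distribution of one observation of the node `v` when leaf `m` is the target: `g l` if `v` is on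
level `l` and contains the target, `f l` if it does not. -/
noncomputable def nodeLaw (f g : ℕ → Measure Bool) (m : ℕ) (v : Node) : Measure Bool :=
  open Classical in if Contains v m then g v.1 else f v.1

/-- Joint law, when leaf `m` is the target, of all the potential observations: `ω (t, v)` is what is
observed if the node `v` is probed at time `t`. They are independent. -/
noncomputable def obsLaw (f g : ℕ → Measure Bool) (m : ℕ) : Measure (ℕ × Node → Bool) :=
  Measure.infinitePi fun x => nodeLaw f g m x.2

namespace Strategy

/-- The first `t` observations of the strategy, most recent first. -/
def history (Γ : Strategy) (ω : ℕ × Node → Bool) : ℕ → List Bool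
  | 0 => []
  | t + 1 => ω (t, Γ.select (Γ.history ω t)) :: Γ.history ω t

/-- The stopping time, i.e. the number of observations taken (`∞` if the search never stops). -/
noncomputable def stoppingTime (Γ : Strategy) (ω : ℕ × Node → Bool) : ℝ≥0∞ :=
  ⨅ (t : ℕ) (_ : Γ.halt (Γ.history ω t)), (t : ℝ≥0∞)

/-- The search stops and declares leaf `m`. -/
def Declares (Γ : Strategy) (m : ℕ) (ω : ℕ × Node → Bool) : Prop :=
  ∃ t : ℕ, Γ.halt (Γ.history ω t) ∧ (∀ s < t, ¬ Γ.halt (Γ.history ω s)) ∧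
    Γ.declare (Γ.history ω t) = m

/-- Detection error probability under the prior `π`. A search that never stops counts as an
error. -/
noncomputable def errorProb (Γ : Strategy) (f g : ℕ → Measure Bool) {M : ℕ} (π : PMF (Fin M)) :
    ℝ≥0∞ :=
  ∑ m : Fin M, π m * obsLaw f g m {ω | ¬ Γ.Declares m ω}

/-- Sample complexity: the expected number of observations under the prior `π`. -/
noncomputable def sampleComplexity (Γ : Strategy) (f g : ℕ → Measure Bool) {M : ℕ}
    (π : PMF (Fin M)) : ℝ≥0∞ :=
  ∑ m : Fin M, π m * ∫⁻ ω, Γ.stoppingTime ω ∂(obsLaw f g m)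

/-- Bayes risk: a loss of `1` for a wrong declaration and a cost `c` for each observation. -/
noncomputable def bayesRisk (Γ : Strategy) (f g : ℕ → Measure Bool) {M : ℕ} (π : PMF (Fin M))
    (c : ℝ) : ℝ≥0∞ :=
  Γ.errorProb f g π + ENNReal.ofReal c * Γ.sampleComplexity f g π

end Strategy

/-! ### The information-directed random walk -/

/-- Log-likelihood ratio `log (g_l(y) / f_l(y))` of one observation of a node on level `l`. -/
noncomputable def llr (f g : ℕ → Measure Bool) (l : ℕ) (y : Bool) : ℝ :=
  Real.log ((g l).real {y} / (f l).real {y})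

/-- Sum of the log-likelihood ratios of a list of observations of a node on level `l`. -/
noncomputable def sllr (f g : ℕ → Measure Bool) (l : ℕ) (ys : List Bool) : ℝ :=
  (ys.map (llr f g l)).sum

/-- Probability that the local test with `k` samples from each of the two children, which are on
level `l`, has a strictly larger and positive sum of log-likelihood ratios at the child containing
the target, when one of them does. -/
noncomputable def confG (f g : ℕ → Measure Bool) (l k : ℕ) : ℝ :=
  ((Measure.pi fun _ : Fin k => g l).prod (Measure.pi fun _ : Fin k => f l)).real
    {x | max (∑ n, llr f g l (x.2 n)) 0 < ∑ n, llr f g l (x.1 n)}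

/-- Probability that both sums of log-likelihood ratios of this local test are negative, when no
child contains the target. -/
noncomputable def confF (f g : ℕ → Measure Bool) (l k : ℕ) : ℝ :=
  ((Measure.pi fun _ : Fin k => f l).real {z | ∑ n, llr f g l (z n) < 0}) ^ 2

/-- State of the random walk: the current node, the observations collected so far during the current
visit to it (most recent first), and whether the search has terminated. -/
structure WalkState where
  node : Node
  buffer : List Bool
  done : Prop

/-- The node probed in a given state: a leaf is probed itself; on level `l + 1`, the first
`K (l + 1)` samples are taken from the left child and the next `K (l + 1)` from the right child. -/
def probe (K : ℕ → ℕ) (s : WalkState) : Node :=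
  match s.node with
  | (0, i) => (0, i)
  | (l + 1, i) => if s.buffer.length < K (l + 1) then (l, 2 * i) else (l, 2 * i + 1)

open Classical in
/-- Update of the state after a new observation `y`.

On a leaf, the walk returns to the parent once the sum of log-likelihood ratios of the current visit
is negative, and the search terminates once this sum exceeds `log (log₂ M / c)`, with `M = 2 ^ n`.

On level `l + 1`, once `K (l + 1)` samples of each child have been collected, the walk moves to the
parent if both sums of log-likelihood ratios are negative, and otherwise to the child with the
larger sum; `tie v` says whether equal sums at the node `v` are resolved in favour of the left
child. -/
noncomputable def walkStep (f g : ℕ → Measure Bool) (K : ℕ → ℕ) (tie : Node → Prop) (n : ℕ) (c : ℝ)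
    (s : WalkState) (y : Bool) : WalkState :=
  match s.node with
  | (0, i) =>
    if sllr f g 0 (y :: s.buffer) < 0 then ⟨parent n (0, i), [], s.done⟩
    else if Real.log (Real.logb 2 (2 ^ n) / c) < sllr f g 0 (y :: s.buffer) then
      ⟨(0, i), y :: s.buffer, True⟩
    else ⟨(0, i), y :: s.buffer, s.done⟩
  | (l + 1, i) =>
    if (y :: s.buffer).length < 2 * K (l + 1) then ⟨(l + 1, i), y :: s.buffer, s.done⟩
    else
      let left := sllr f g l ((y :: s.buffer).drop (K (l + 1)))
      let right := sllr f g l ((y :: s.buffer).take (K (l + 1)))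
      if left < 0 ∧ right < 0 then ⟨parent n (l + 1, i), [], s.done⟩
      else if right < left ∨ (right = left ∧ tie (l + 1, i)) then ⟨(l, 2 * i), [], s.done⟩
      else ⟨(l, 2 * i + 1), [], s.done⟩

/-- State of the walk after a given observation history; the walk starts at the root. -/
noncomputable def walkState (f g : ℕ → Measure Bool) (K : ℕ → ℕ) (tie : Node → Prop) (n : ℕ)
    (c : ℝ) : List Bool → WalkState
  | [] => ⟨(n, 0), [], False⟩
  | y :: ys => walkStep f g K tie n c (walkState f g K tie n c ys) y

/-- The information-directed random walk policy on the tree with `2 ^ n` leaves, with local sample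
sizes `K` and sampling cost `c`. -/
noncomputable def irw (f g : ℕ → Measure Bool) (K : ℕ → ℕ) (tie : Node → Prop) (n : ℕ) (c : ℝ) :
    Strategy where
  select h := probe K (walkState f g K tie n c h)
  halt h := (walkState f g K tie n c h).done
  declare h := (walkState f g K tie n c h).node.2

/-! ### The Bernoulli model and the local sample sizes -/

/-- Target-absent distributions: Bernoulli with parameter `μ l` on level `l`. -/
noncomputable def bernF (μ : ℕ → unitInterval) (l : ℕ) : Measure Bool :=
  bernoulliMeasure true false (μ l)

/-- Target-present distributions: Bernoulli with parameter `1 - μ l` on level `l`. -/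
noncomputable def bernG (μ : ℕ → unitInterval) (l : ℕ) : Measure Bool :=
  bernoulliMeasure true false (unitInterval.symm (μ l))

/-- The smallest local sample sizes for which the local tests on all levels have confidence
greater than `p`. -/
noncomputable def minimalSize (f g : ℕ → Measure Bool) (p : ℝ) : ℕ → ℕ
  | 0 => 0
  | l + 1 => sInf {k | p < confG f g l k ∧ p < confF f g l k}

/-- The explicit local sample sizes
`K_l = 12 (1 - μ_{l-1}) log (1 / (1 - η)) / (1 - 2 μ_{l-1})²`, rounded up to an integer. -/
noncomputable def chernoffSize (μ : ℕ → unitInterval) (η : ℝ) : ℕ → ℕ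
  | 0 => 0
  | l + 1 => ⌈12 * (1 - (μ l : ℝ)) * Real.log (1 / (1 - η)) / (1 - 2 * (μ l : ℝ)) ^ 2⌉₊

end TreeSearch

namespace TreeSearch

open MeasureTheory ProbabilityTheory
open scoped ENNReal BigOperators

/-! ### A drift criterion for search strategies -/

/-! The proof is a Lyapunov argument. A nonnegative function of the history that loses on average at
least `c` per observation, and is at least 1 at a wrong declaration, bounds error probability plus
`c` times expected duration by its initial value (`error_add_mul_stoppingTime_le`). Everything else
constructs such a function for the walk and bounds it at the root.

At internal nodes only the tree distance `d` to the target leaf matters. A correct test lowers `d`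
by one and has probability above `p > 1/2`; any other outcome raises `d` by at most one. A node of
level `l` satisfies `l ≤ min d (2n - d)` (`le_targetDist_and_add_le`), and a Chernoff bound gives
`K_l = O(α^(2l))`. So the walk is dominated by a biased walk on `{0, …, 2n}` paying `O(α^(2 min(d,
2n-d)))` at `d`. These payments sum to `O(α^(2n))`, and so does the potential `W` of that walk
(`exists_potential`); `α^(2n)` is `M^(log₂ α²)`.

At a leaf the running sum `S` has linear drift, and `exp (-S)` (on the target) or `exp S`
(elsewhere) is a martingale. On the target, the linear term gives `log(n/c)/D`, and a multiple `E
exp (-S)` prepays the excursion after a mistaken retreat, so the main term keeps constant `1/D`. Off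
the target, `exp S / n` reaches `1/c` at the threshold and thus pays for a wrong declaration, while
costing only `1/n ≤ 1` at the start of a visit. Since these leaf potentials are exactly balanced
(`sum_leafPotential`), only the moves between nodes need inequalities, collected in `IsPotential`.
-/

instance isProbabilityMeasure_nodeLaw (f g : ℕ → Measure Bool) [∀ l, IsProbabilityMeasure (f l)]
    [∀ l, IsProbabilityMeasure (g l)] (m : ℕ) (v : Node) :
    IsProbabilityMeasure (nodeLaw f g m v) := by
  unfold nodeLaw; split_ifs <;> infer_instance

instance isProbabilityMeasure_obsLaw (f g : ℕ → Measure Bool) [∀ l, IsProbabilityMeasure (f l)]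
    [∀ l, IsProbabilityMeasure (g l)] (m : ℕ) :
    IsProbabilityMeasure (obsLaw f g m) := by
  unfold obsLaw; infer_instance

namespace Strategy

variable (Γ : Strategy)

lemma length_history (ω : ℕ × Node → Bool) (t : ℕ) : (Γ.history ω t).length = t := by
  induction t with
  | zero => rfl
  | succ t ih => simp [history, ih]

/-- Once the past is fixed to be `h`, the adaptively chosen probe is a fixed coordinate, so one more
observation constrains just that coordinate. -/
lemma history_cons_eq_pi (y : Bool) {h : List Bool} {s : Finset (ℕ × Node)}
    {T : ℕ × Node → Set Bool} (hne : (h.length, Γ.select h) ∉ s)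
    (hT : {ω | Γ.history ω h.length = h} = (s : Set (ℕ × Node)).pi T) :
    {ω | Γ.history ω (h.length + 1) = y :: h}
      = ((insert (h.length, Γ.select h) s : Finset (ℕ × Node)) : Set (ℕ × Node)).pi
          (Function.update T (h.length, Γ.select h) {y}) := by
  have : (s : Set (ℕ × Node)).pi (Function.update T (h.length, Γ.select h) {y})
      = (s : Set (ℕ × Node)).pi T := by
    refine Set.pi_congr rfl fun x hx => ?_
    rw [Function.update_of_ne]
    rintro rfl
    exact hne hx
  rw [Finset.coe_insert, Set.insert_pi, this, ← hT]
  ext ω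
  simp only [history, Set.mem_ofPred_eq, List.cons.injEq, Function.update_self,
    Set.mem_inter_iff, Set.mem_preimage, Function.eval, Set.mem_singleton_iff]
  constructor
  · rintro ⟨h1, h2⟩
    rw [h2] at h1
    exact ⟨h1, h2⟩
  · rintro ⟨h1, h2⟩
    rw [h2]
    exact ⟨h1, rfl⟩

/-- The event of a given observation history is a cylinder on observations at earlier times. -/
lemma exists_cylinder_history (h : List Bool) :
    ∃ (s : Finset (ℕ × Node)) (T : ℕ × Node → Set Bool), (∀ x ∈ s, x.1 < h.length) ∧
      {ω | Γ.history ω h.length = h} = (s : Set (ℕ × Node)).pi T := by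
  induction h with
  | nil => exact ⟨∅, fun _ => Set.univ, by simp, by simp [history]⟩
  | cons y h ih =>
    obtain ⟨s, T, hs, hT⟩ := ih
    refine ⟨insert (h.length, Γ.select h) s, Function.update T (h.length, Γ.select h) {y}, ?_,
      Γ.history_cons_eq_pi y (fun hx => absurd (hs _ hx) (by simp)) hT⟩
    intro x hx
    rcases Finset.mem_insert.1 hx with rfl | hx
    · simp
    · have := hs x hx; simp; omega

lemma measurableSet_history_eq (t : ℕ) (h : List Bool) :
    MeasurableSet {ω | Γ.history ω t = h} := by
  by_cases ht : h.length = t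
  · subst ht
    obtain ⟨s, T, -, hT⟩ := Γ.exists_cylinder_history h
    rw [hT]
    exact MeasurableSet.pi s.countable_toSet fun _ _ => MeasurableSet.of_discrete
  · have : {ω | Γ.history ω t = h} = ∅ := by
      ext ω
      simp only [Set.mem_ofPred_eq, Set.mem_empty_iff_false, iff_false]
      rintro rfl
      exact ht (Γ.length_history ω t)
    rw [this]
    exact MeasurableSet.empty

lemma measurable_comp_history {β : Type*} [MeasurableSpace β] (F : List Bool → β) (t : ℕ) :
    Measurable fun ω => F (Γ.history ω t) := by
  let _ : MeasurableSpace (List Bool) := ⊤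
  have h1 : Measurable fun ω => Γ.history ω t :=
    measurable_to_countable' fun h => Γ.measurableSet_history_eq t h
  exact (measurable_from_top (f := F)).comp h1

lemma lintegral_comp_history (f g : ℕ → Measure Bool) (m : ℕ) (F : List Bool → ℝ≥0∞)
    (t : ℕ) :
    ∫⁻ ω, F (Γ.history ω t) ∂(obsLaw f g m)
      = ∑' h : List Bool, F h * obsLaw f g m {ω | Γ.history ω t = h} := by
  let _ : MeasurableSpace (List Bool) := ⊤
  have h1 : Measurable fun ω => Γ.history ω t :=
    measurable_to_countable' fun h => Γ.measurableSet_history_eq t h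
  rw [← lintegral_map (g := fun ω => Γ.history ω t) (measurable_from_top (f := F)) h1,
    lintegral_countable']
  refine tsum_congr fun h => ?_
  rw [Measure.map_apply h1 trivial]
  rfl

variable (f g : ℕ → Measure Bool) [∀ l, IsProbabilityMeasure (f l)]
  [∀ l, IsProbabilityMeasure (g l)] (m : ℕ)

/-- The past only involves coordinates with an earlier time stamp, so the newly read coordinate is
independent of it even if the same node was probed before. -/
lemma obsLaw_history_cons (y : Bool) (h : List Bool) :
    obsLaw f g m {ω | Γ.history ω (h.length + 1) = y :: h}
      = nodeLaw f g m (Γ.select h) {y} * obsLaw f g m {ω | Γ.history ω h.length = h} := by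
  obtain ⟨s, T, hs, hT⟩ := Γ.exists_cylinder_history h
  have hne : (h.length, Γ.select h) ∉ s := fun hx => absurd (hs _ hx) (by simp)
  rw [Γ.history_cons_eq_pi y hne hT, hT, obsLaw, Measure.infinitePi_pi _ fun _ _ => MeasurableSet.of_discrete,
    Measure.infinitePi_pi _ fun _ _ => MeasurableSet.of_discrete, Finset.prod_insert hne]
  congr 1
  · simp
  · refine Finset.prod_congr rfl fun x hx => ?_
    rw [Function.update_of_ne]
    rintro rfl
    exact hne hx

/-- Plays the role of conditioning on the past: there are countably many histories, so both sides
split over them and no conditional expectation is needed. -/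
lemma lintegral_comp_history_succ (F : List Bool → ℝ≥0∞) (t : ℕ) :
    ∫⁻ ω, F (Γ.history ω (t + 1)) ∂(obsLaw f g m)
      = ∫⁻ ω, ∑ y, nodeLaw f g m (Γ.select (Γ.history ω t)) {y} * F (y :: Γ.history ω t)
          ∂(obsLaw f g m) := by
  have hsplit : ∀ ω, F (Γ.history ω (t + 1)) = ∑ y : Bool, ∑' h : List Bool,
      ({ω | Γ.history ω (t + 1) = y :: h}.indicator (fun _ => F (y :: h)) ω) := by
    intro ω
    rw [Finset.sum_eq_single (ω (t, Γ.select (Γ.history ω t))),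
      tsum_eq_single (Γ.history ω t)]
    · simp [history]
    · intro h hh
      apply Set.indicator_of_notMem
      simp only [history, Set.mem_ofPred_eq, List.cons.injEq, not_and]
      intro _ h2
      exact hh h2.symm
    · intro y _ hy
      rw [ENNReal.tsum_eq_zero]
      intro h
      apply Set.indicator_of_notMem
      simp only [history, Set.mem_ofPred_eq, List.cons.injEq, not_and]
      intro h1
      exact absurd h1.symm hy
    · simp
  simp_rw [hsplit]
  rw [lintegral_finsetSum _ fun y _ => Measurable.tsum fun h =>
      measurable_const.indicator (Γ.measurableSet_history_eq _ _),
    lintegral_finsetSum _ fun y _ => Γ.measurable_comp_history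
      (fun h => nodeLaw f g m (Γ.select h) {y} * F (y :: h)) t]
  refine Finset.sum_congr rfl fun y _ => ?_
  rw [lintegral_tsum fun h =>
      (measurable_const.indicator (Γ.measurableSet_history_eq _ _)).aemeasurable,
    Γ.lintegral_comp_history f g m (fun h => nodeLaw f g m (Γ.select h) {y} * F (y :: h)) t]
  refine tsum_congr fun h => ?_
  rw [lintegral_indicator_const (Γ.measurableSet_history_eq _ _)]
  by_cases hl : h.length = t
  · subst hl
    rw [obsLaw_history_cons]
    ring
  · have e1 : {ω | Γ.history ω t = h} = ∅ := by
      ext ω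
      simp only [Set.mem_ofPred_eq, Set.mem_empty_iff_false, iff_false]
      rintro rfl
      exact hl (Γ.length_history ω t)
    have e2 : {ω | Γ.history ω (t + 1) = y :: h} = ∅ := by
      ext ω
      simp only [history, Set.mem_ofPred_eq, List.cons.injEq, Set.mem_empty_iff_false, iff_false]
      rintro ⟨-, rfl⟩
      exact hl (Γ.length_history ω t)
    rw [e1, e2]
    simp

/-- The strategy has not stopped before the last observation of the history. -/
def Alive : List Bool → Prop
  | [] => True
  | _ :: h => Alive h ∧ ¬ Γ.halt h

lemma alive_history (ω : ℕ × Node → Bool) (t : ℕ) :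
    Γ.Alive (Γ.history ω t) ↔ ∀ s < t, ¬ Γ.halt (Γ.history ω s) := by
  induction t with
  | zero => simp [history, Alive]
  | succ t ih =>
    simp only [history, Alive, ih, Nat.lt_succ_iff_lt_or_eq]
    constructor
    · rintro ⟨h1, h2⟩ s (hs | rfl)
      · exact h1 s hs
      · exact h2
    · intro h
      exact ⟨fun s hs => h s (Or.inl hs), h t (Or.inr rfl)⟩

open Classical in
/-- The stopping time is at most the number of times at which the strategy is still running. -/
lemma stoppingTime_le_tsum (ω : ℕ × Node → Bool) :
    Γ.stoppingTime ω ≤ ∑' t : ℕ,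
      if Γ.Alive (Γ.history ω t) ∧ ¬ Γ.halt (Γ.history ω t) then (1 : ℝ≥0∞) else 0 := by
  by_cases hex : ∃ t, Γ.halt (Γ.history ω t)
  · have hle : Γ.stoppingTime ω ≤ (Nat.find hex : ℝ≥0∞) :=
      iInf₂_le (Nat.find hex) (Nat.find_spec hex)
    refine hle.trans (le_trans ?_ (ENNReal.sum_le_tsum (Finset.range (Nat.find hex))))
    rw [Finset.sum_congr rfl (g := fun _ => (1 : ℝ≥0∞))]
    · simp
    · intro t ht
      have ht' := Finset.mem_range.1 ht
      rw [if_pos ⟨(Γ.alive_history ω t).2 fun s hs => Nat.find_min hex (hs.trans ht'),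
        Nat.find_min hex ht'⟩]
  · push Not at hex
    have : (∑' t : ℕ,
      if Γ.Alive (Γ.history ω t) ∧ ¬ Γ.halt (Γ.history ω t) then (1 : ℝ≥0∞) else 0) = ⊤ := by
      rw [tsum_congr (g := fun _ => (1 : ℝ≥0∞)), ENNReal.tsum_const_eq_top_of_ne_zero one_ne_zero]
      intro t
      rw [if_pos ⟨(Γ.alive_history ω t).2 fun s _ => hex s, hex t⟩]
    rw [this]
    exact le_top

open Classical in
/-- **Drift criterion.** A nonnegative function of the history which decreases on average by at
least `κ` with each observation, and which is at least `1` at a wrong declaration, bounds the error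
probability plus `κ` times the expected number of observations. -/
theorem error_add_mul_stoppingTime_le (κ : ℝ≥0∞) (hκ : κ ≠ 0) (Φ : List Bool → ℝ≥0∞)
    (hfin : Φ [] ≠ ⊤) (hhalt : ∀ h, Γ.halt h → Γ.declare h ≠ m → 1 ≤ Φ h)
    (hdrift : ∀ h, ¬ Γ.halt h →
      κ + ∑ y, nodeLaw f g m (Γ.select h) {y} * Φ (y :: h) ≤ Φ h) :
    obsLaw f g m {ω | ¬ Γ.Declares m ω} + κ * ∫⁻ ω, Γ.stoppingTime ω ∂(obsLaw f g m) ≤ Φ [] := by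
  set P := obsLaw f g m
  set A : List Bool → ℝ≥0∞ :=
    fun h => if Γ.Alive h ∧ Γ.halt h ∧ Γ.declare h ≠ m then 1 else 0 with hA
  set R : List Bool → ℝ≥0∞ := fun h => if Γ.Alive h ∧ ¬ Γ.halt h then 1 else 0 with hR
  set E : List Bool → ℝ≥0∞ := fun h => if Γ.Alive h then Φ h else 0 with hE
  have hmeas : ∀ (F : List Bool → ℝ≥0∞) t, Measurable fun ω => F (Γ.history ω t) :=
    fun F t => Γ.measurable_comp_history F t
  -- `E` is the potential killed after stopping. Its loss in one step pays for a wrong stop at time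
  -- `t` or for one more observation; summing over `t` telescopes.
  have hstep : ∀ t, (∫⁻ ω, A (Γ.history ω t) ∂P + κ * ∫⁻ ω, R (Γ.history ω t) ∂P)
      + ∫⁻ ω, E (Γ.history ω (t + 1)) ∂P ≤ ∫⁻ ω, E (Γ.history ω t) ∂P := by
    intro t
    rw [Γ.lintegral_comp_history_succ f g m, ← lintegral_const_mul _ (hmeas R t),
      ← lintegral_add_left (hmeas A t),
      ← lintegral_add_left (hmeas (fun h => A h + κ * R h) t)]
    refine lintegral_mono fun ω => ?_
    generalize Γ.history ω t = h
    simp only [hA, hR, hE, Alive]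
    by_cases ha : Γ.Alive h
    · by_cases hh : Γ.halt h
      · by_cases hd : Γ.declare h = m
        · simp [ha, hh, hd]
        · simpa [ha, hh, hd] using hhalt h hh hd
      · simpa [ha, hh] using hdrift h hh
    · simp [ha]
  have hsum : ∀ N, ∑ t ∈ Finset.range N,
      (∫⁻ ω, A (Γ.history ω t) ∂P + κ * ∫⁻ ω, R (Γ.history ω t) ∂P)
        + ∫⁻ ω, E (Γ.history ω N) ∂P ≤ Φ [] := by
    intro N
    induction N with
    | zero => simp [history, hE, Alive, P]
    | succ N ih =>
      rw [Finset.sum_range_succ, add_assoc]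
      exact (add_le_add le_rfl (hstep N)).trans ih
  have htsum : ∑' t, (∫⁻ ω, A (Γ.history ω t) ∂P) + κ * ∑' t, ∫⁻ ω, R (Γ.history ω t) ∂P
      ≤ Φ [] := by
    rw [← ENNReal.tsum_mul_left, ← ENNReal.tsum_add, ENNReal.tsum_eq_iSup_nat]
    exact iSup_le fun N => le_self_add.trans (hsum N)
  have hRfin : ∑' t, ∫⁻ ω, R (Γ.history ω t) ∂P ≠ ⊤ := by
    intro htop
    rw [htop, ENNReal.mul_top hκ, add_top] at htsum
    exact hfin (top_le_iff.1 htsum)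
  -- The probabilities of still running are summable, hence tend to 0; so never stopping, which
  -- counts as an error, has probability 0.
  have hnever : P {ω | ∀ t, ¬ Γ.halt (Γ.history ω t)} = 0 := by
    have hle : ∀ t, P {ω | ∀ t, ¬ Γ.halt (Γ.history ω t)} ≤ ∫⁻ ω, R (Γ.history ω t) ∂P := by
      intro t
      have hms : MeasurableSet {ω | Γ.Alive (Γ.history ω t) ∧ ¬ Γ.halt (Γ.history ω t)} :=
        measurableSet_setOfPred.2
          (Γ.measurable_comp_history (fun h => Γ.Alive h ∧ ¬ Γ.halt h) t)
      have : ∫⁻ ω, R (Γ.history ω t) ∂P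
          = P {ω | Γ.Alive (Γ.history ω t) ∧ ¬ Γ.halt (Γ.history ω t)} := by
        rw [← lintegral_indicator_one hms]
        refine lintegral_congr fun ω => ?_
        simp [hR, Set.indicator_apply]
      rw [this]
      exact measure_mono fun ω hω => ⟨(Γ.alive_history ω t).2 fun s _ => hω s, hω t⟩
    exact le_antisymm (ge_of_tendsto' (ENNReal.tendsto_atTop_zero_of_tsum_ne_top hRfin) hle)
      bot_le
  have herr : P {ω | ¬ Γ.Declares m ω} ≤ ∑' t, ∫⁻ ω, A (Γ.history ω t) ∂P := by
    have hcov : {ω | ¬ Γ.Declares m ω} ⊆ {ω | ∀ t, ¬ Γ.halt (Γ.history ω t)} ∪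
        ⋃ t, {ω | Γ.Alive (Γ.history ω t) ∧ Γ.halt (Γ.history ω t) ∧
          Γ.declare (Γ.history ω t) ≠ m} := by
      intro ω hω
      by_cases hex : ∃ t, Γ.halt (Γ.history ω t)
      · refine Or.inr (Set.mem_iUnion.2 ⟨Nat.find hex, ?_, Nat.find_spec hex, fun hd => hω ?_⟩)
        · exact (Γ.alive_history ω _).2 fun s hs => Nat.find_min hex hs
        · exact ⟨Nat.find hex, Nat.find_spec hex, fun s hs => Nat.find_min hex hs, hd⟩
      · exact Or.inl (not_exists.1 hex)
    refine (measure_mono hcov).trans ((measure_union_le _ _).trans ?_)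
    rw [hnever, zero_add]
    refine (measure_iUnion_le _).trans (ENNReal.tsum_le_tsum fun t => ?_)
    have hms : MeasurableSet {ω | Γ.Alive (Γ.history ω t) ∧ Γ.halt (Γ.history ω t) ∧
          Γ.declare (Γ.history ω t) ≠ m} :=
      measurableSet_setOfPred.2
        (Γ.measurable_comp_history (fun h => Γ.Alive h ∧ Γ.halt h ∧ Γ.declare h ≠ m) t)
    rw [← lintegral_indicator_one hms]
    refine lintegral_mono fun ω => ?_
    simp [hA, Set.indicator_apply]
  have htime : ∫⁻ ω, Γ.stoppingTime ω ∂P ≤ ∑' t, ∫⁻ ω, R (Γ.history ω t) ∂P := by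
    rw [← lintegral_tsum fun t => (hmeas R t).aemeasurable]
    exact lintegral_mono fun ω => Γ.stoppingTime_le_tsum ω
  exact (add_le_add herr (mul_le_mul_right htime κ)).trans htsum

end Strategy

/-! ### The Bernoulli model -/

instance isProbabilityMeasure_bernF (μ : ℕ → unitInterval) (l : ℕ) :
    IsProbabilityMeasure (bernF μ l) := by
  unfold bernF; infer_instance

instance isProbabilityMeasure_bernG (μ : ℕ → unitInterval) (l : ℕ) :
    IsProbabilityMeasure (bernG μ l) := by
  unfold bernG; infer_instance

section Bernoulli

variable (μ : ℕ → unitInterval) (l : ℕ)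

@[simp]
lemma bernF_real_true : (bernF μ l).real {true} = μ l := by
  simp [bernF]

@[simp]
lemma bernF_real_false : (bernF μ l).real {false} = 1 - μ l := by
  simp [bernF]

@[simp]
lemma bernG_real_true : (bernG μ l).real {true} = 1 - μ l := by
  simp [bernG]

@[simp]
lemma bernG_real_false : (bernG μ l).real {false} = μ l := by
  simp [bernG]

/-- The step of the log-likelihood ratio random walk of a node on level `l`. -/
noncomputable def llrStep : ℝ := Real.log ((1 - μ l) / μ l)

lemma llr_true : llr (bernF μ) (bernG μ) l true = llrStep μ l := by
  simp [llr, llrStep]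

lemma llr_false : llr (bernF μ) (bernG μ) l false = -llrStep μ l := by
  simp only [llr, llrStep, bernF_real_false, bernG_real_false]
  rw [← Real.log_inv, inv_div]

lemma llrStep_pos (h0 : 0 < (μ l : ℝ)) (h1 : (μ l : ℝ) < 1 / 2) : 0 < llrStep μ l := by
  apply Real.log_pos
  rw [lt_div_iff₀ h0]
  linarith

lemma exp_llrStep (h0 : 0 < (μ l : ℝ)) (h1 : (μ l : ℝ) < 1 / 2) :
    Real.exp (llrStep μ l) = (1 - μ l) / μ l := by
  apply Real.exp_log
  apply div_pos _ h0
  linarith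

/-- Chernoff bound for a sum of independent copies of a function of a coin flip. -/
lemma measureReal_sum_nonneg_le (ν : Measure Bool) [IsProbabilityMeasure ν] (φ : Bool → ℝ)
    (k : ℕ) :
    (Measure.pi fun _ : Fin k => ν).real {z | 0 ≤ ∑ n, φ (z n)}
      ≤ (∫ y, Real.exp (φ y) ∂ν) ^ k := by
  have h1 := mul_meas_ge_le_integral_of_nonneg (μ := Measure.pi fun _ : Fin k => ν)
    (f := fun z => Real.exp (∑ n, φ (z n)))
    (Filter.Eventually.of_forall fun z => (Real.exp_pos _).le) (Integrable.of_finite) 1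
  have h2 : ∫ z, Real.exp (∑ n, φ (z n)) ∂(Measure.pi fun _ : Fin k => ν)
      = (∫ y, Real.exp (φ y) ∂ν) ^ k := by
    simp_rw [Real.exp_sum]
    rw [integral_fintype_prod_eq_pow (ι := Fin k) (fun y => Real.exp (φ y))]
    simp
  rw [h2, one_mul] at h1
  convert h1 using 3
  ext z
  simp [Real.one_le_exp_iff]

/-- Bound on the Bhattacharyya coefficient of the two Bernoulli laws. -/
lemma integral_exp_half_llr_le (h0 : 0 < (μ l : ℝ)) (h1 : (μ l : ℝ) < 1 / 2) :
    (μ l : ℝ) * Real.exp (llrStep μ l / 2) + (1 - μ l) * Real.exp (-(llrStep μ l / 2))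
      ≤ Real.exp (-((1 - 2 * μ l) ^ 2 / 2)) := by
  set x : ℝ := (μ l : ℝ)
  set e := Real.exp (llrStep μ l / 2) with he
  have hepos : 0 < e := Real.exp_pos _
  have he2 : e ^ 2 = (1 - x) / x := by
    rw [he, ← Real.exp_nat_mul, ← exp_llrStep μ l h0 h1]
    congr 1
    push_cast
    ring
  have hx1 : 0 < 1 - x := by linarith
  rw [Real.exp_neg]
  refine le_of_sq_le_sq ?_ (Real.exp_pos _).le
  -- As `e = √((1-x)/x)`, the coefficient is `2√(x(1-x))`.
  have hsq : (x * e + (1 - x) * e⁻¹) ^ 2 = 1 - (1 - 2 * x) ^ 2 := by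
    have : (x * e + (1 - x) * e⁻¹) ^ 2
        = x ^ 2 * e ^ 2 + 2 * x * (1 - x) * (e * e⁻¹) + (1 - x) ^ 2 * (e ^ 2)⁻¹ := by
      rw [← inv_pow]
      ring
    rw [this, he2, mul_inv_cancel₀ hepos.ne']
    field_simp
    ring
  rw [hsq, ← Real.exp_nat_mul]
  have := Real.add_one_le_exp (-((1 - 2 * x) ^ 2))
  have e3 : ((2 : ℕ) : ℝ) * -((1 - 2 * x) ^ 2 / 2) = -((1 - 2 * x) ^ 2) := by push_cast; ring
  rw [e3]
  linarith

/-- Chernoff bound with exponent `1/2`, for which the exponential moment is the Bhattacharyya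
coefficient; the same bound then serves under `g`. -/
lemma bernF_sum_llr_neg (h0 : 0 < (μ l : ℝ)) (h1 : (μ l : ℝ) < 1 / 2) (k : ℕ) :
    1 - Real.exp (-(k * (1 - 2 * μ l) ^ 2 / 2)) ≤
      (Measure.pi fun _ : Fin k => bernF μ l).real
        {z | ∑ n, llr (bernF μ) (bernG μ) l (z n) < 0} := by
  have hb := measureReal_sum_nonneg_le (bernF μ l) (fun y => llr (bernF μ) (bernG μ) l y / 2) k
  have hi : ∫ y, Real.exp (llr (bernF μ) (bernG μ) l y / 2) ∂(bernF μ l)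
      = (μ l : ℝ) * Real.exp (llrStep μ l / 2) + (1 - μ l) * Real.exp (-(llrStep μ l / 2)) := by
    rw [integral_fintype Integrable.of_finite]
    simp [llr_true, llr_false, neg_div]
  have hc : {z : Fin k → Bool | ∑ n, llr (bernF μ) (bernG μ) l (z n) < 0}
      = {z | 0 ≤ ∑ n, llr (bernF μ) (bernG μ) l (z n) / 2}ᶜ := by
    ext z
    simp only [Set.mem_ofPred_eq, Set.mem_compl_iff, not_le, ← Finset.sum_div]
    constructor <;> intro h <;> linarith
  rw [hc, probReal_compl_eq_one_sub MeasurableSet.of_discrete]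
  rw [hi] at hb
  have hp := pow_le_pow_left₀ (by
    have := h0.le
    have : 0 ≤ 1 - (μ l : ℝ) := by linarith
    positivity) (integral_exp_half_llr_le μ l h0 h1) k
  rw [← Real.exp_nat_mul] at hp
  have e : (k : ℝ) * -((1 - 2 * (μ l : ℝ)) ^ 2 / 2) = -(k * (1 - 2 * μ l) ^ 2 / 2) := by ring
  rw [e] at hp
  linarith

lemma bernG_sum_llr_pos (h0 : 0 < (μ l : ℝ)) (h1 : (μ l : ℝ) < 1 / 2) (k : ℕ) :
    1 - Real.exp (-(k * (1 - 2 * μ l) ^ 2 / 2)) ≤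
      (Measure.pi fun _ : Fin k => bernG μ l).real
        {z | 0 < ∑ n, llr (bernF μ) (bernG μ) l (z n)} := by
  have hb := measureReal_sum_nonneg_le (bernG μ l) (fun y => -llr (bernF μ) (bernG μ) l y / 2) k
  have hi : ∫ y, Real.exp (-llr (bernF μ) (bernG μ) l y / 2) ∂(bernG μ l)
      = (μ l : ℝ) * Real.exp (llrStep μ l / 2) + (1 - μ l) * Real.exp (-(llrStep μ l / 2)) := by
    rw [integral_fintype Integrable.of_finite]
    simp [llr_true, llr_false, neg_div, add_comm]
  have hc : {z : Fin k → Bool | 0 < ∑ n, llr (bernF μ) (bernG μ) l (z n)}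
      = {z | 0 ≤ ∑ n, -llr (bernF μ) (bernG μ) l (z n) / 2}ᶜ := by
    ext z
    simp only [Set.mem_ofPred_eq, Set.mem_compl_iff, not_le, ← Finset.sum_div,
      Finset.sum_neg_distrib]
    constructor <;> intro h <;> linarith
  rw [hc, probReal_compl_eq_one_sub MeasurableSet.of_discrete]
  rw [hi] at hb
  have hp := pow_le_pow_left₀ (by
    have := h0.le
    have : 0 ≤ 1 - (μ l : ℝ) := by linarith
    positivity) (integral_exp_half_llr_le μ l h0 h1) k
  rw [← Real.exp_nat_mul] at hp
  have e : (k : ℝ) * -((1 - 2 * (μ l : ℝ)) ^ 2 / 2) = -(k * (1 - 2 * μ l) ^ 2 / 2) := by ring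
  rw [e] at hp
  linarith

lemma one_sub_exp_nonneg (k : ℕ) :
    0 ≤ 1 - Real.exp (-(k * (1 - 2 * (μ l : ℝ)) ^ 2 / 2)) := by
  rw [sub_nonneg, Real.exp_le_one_iff, neg_nonpos]
  positivity

lemma le_confF (h0 : 0 < (μ l : ℝ)) (h1 : (μ l : ℝ) < 1 / 2) (k : ℕ) :
    (1 - Real.exp (-(k * (1 - 2 * μ l) ^ 2 / 2))) ^ 2 ≤ confF (bernF μ) (bernG μ) l k :=
  pow_le_pow_left₀ (one_sub_exp_nonneg μ l k) (bernF_sum_llr_neg μ l h0 h1 k) 2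

/-- It suffices that the target child has a positive sum and the other child a negative one; these
events are independent. -/
lemma le_confG (h0 : 0 < (μ l : ℝ)) (h1 : (μ l : ℝ) < 1 / 2) (k : ℕ) :
    (1 - Real.exp (-(k * (1 - 2 * μ l) ^ 2 / 2))) ^ 2 ≤ confG (bernF μ) (bernG μ) l k := by
  have hsub : {z : Fin k → Bool | 0 < ∑ n, llr (bernF μ) (bernG μ) l (z n)} ×ˢ
      {z : Fin k → Bool | ∑ n, llr (bernF μ) (bernG μ) l (z n) < 0} ⊆
      {x : (Fin k → Bool) × (Fin k → Bool) | max (∑ n, llr (bernF μ) (bernG μ) l (x.2 n)) 0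
        < ∑ n, llr (bernF μ) (bernG μ) l (x.1 n)} := by
    rintro ⟨a, b⟩ ⟨ha, hb⟩
    simp only [Set.mem_ofPred_eq] at ha hb ⊢
    exact max_lt (hb.trans ha) ha
  refine le_trans ?_ (measureReal_mono hsub)
  rw [measureReal_prod_prod, sq]
  exact mul_le_mul (bernG_sum_llr_pos μ l h0 h1 k) (bernF_sum_llr_neg μ l h0 h1 k)
    (one_sub_exp_nonneg μ l k) measureReal_nonneg

lemma confG_zero (f g : ℕ → Measure Bool) (l : ℕ) : confG f g l 0 = 0 := by
  simp [confG]

lemma confG_le_one (f g : ℕ → Measure Bool) [∀ l, IsProbabilityMeasure (f l)]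
    [∀ l, IsProbabilityMeasure (g l)] (l k : ℕ) : confG f g l k ≤ 1 :=
  measureReal_le_one

/-- The divergence is the drift of the log-likelihood walk under `g`, which is the denominator
produced by the potential at the target leaf. -/
lemma toReal_klDiv_bern (h0 : 0 < (μ l : ℝ)) (h1 : (μ l : ℝ) < 1 / 2) :
    (InformationTheory.klDiv (bernG μ l) (bernF μ l)).toReal = (1 - 2 * μ l) * llrStep μ l := by
  have hx1 : 0 < 1 - (μ l : ℝ) := by linarith
  set r : Bool → ℝ≥0∞ := fun y => ENNReal.ofReal ((bernG μ l).real {y} / (bernF μ l).real {y})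
    with hr
  have hF : ∀ y, 0 < (bernF μ l).real {y} := by
    rintro (_ | _) <;> simp [h0, hx1]
  have hwd : bernG μ l = (bernF μ l).withDensity r := by
    refine Measure.ext_of_singleton fun y => ?_
    rw [withDensity_apply _ (measurableSet_singleton y), Measure.restrict_singleton,
      lintegral_smul_measure, lintegral_dirac, hr, smul_eq_mul,
      ← ofReal_measureReal (μ := bernF μ l), ← ofReal_measureReal (μ := bernG μ l),
      ← ENNReal.ofReal_mul measureReal_nonneg, mul_div_cancel₀ _ (hF y).ne']
  have hac : bernG μ l ≪ bernF μ l := by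
    rw [hwd]
    exact withDensity_absolutelyContinuous _ _
  rw [InformationTheory.toReal_klDiv_of_measure_eq hac
    (by rw [measure_univ, measure_univ])]
  have hrn : ∀ y, (bernG μ l).rnDeriv (bernF μ l) y = r y := by
    have hae := Measure.rnDeriv_withDensity (bernF μ l) (f := r) Measurable.of_discrete
    rw [← hwd] at hae
    intro y
    by_contra hne
    have hsub : ({y} : Set Bool) ⊆ {y | ¬ (bernG μ l).rnDeriv (bernF μ l) y = r y} := by
      rintro _ rfl
      exact hne
    have h3 : (bernF μ l) {y} = 0 := measure_mono_null hsub (ae_iff.1 hae)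
    have h4 := hF y
    rw [measureReal_def, h3] at h4
    simp at h4
  have hll : ∀ y, MeasureTheory.llr (bernG μ l) (bernF μ l) y
      = TreeSearch.llr (bernF μ) (bernG μ) l y := by
    intro y
    rw [MeasureTheory.llr, hrn, TreeSearch.llr, hr, ENNReal.toReal_ofReal
      (div_nonneg measureReal_nonneg measureReal_nonneg)]
  simp_rw [hll]
  rw [integral_fintype Integrable.of_finite]
  simp [llr_true, llr_false]
  ring

end Bernoulli

/-! ### Confidence and size of the local tests -/

section Sizes

variable {μ : ℕ → unitInterval}

lemma lt_conf_of_lt (p : ℝ) {l : ℕ} (h0 : 0 < (μ l : ℝ)) (h1 : (μ l : ℝ) < 1 / 2) {k : ℕ} {s : ℝ}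
    (hs : s / (1 - 2 * μ l) ^ 2 ≤ k) (hs0 : 0 ≤ s) (hp : p < (1 - Real.exp (-(s / 2))) ^ 2) :
    p < confG (bernF μ) (bernG μ) l k ∧ p < confF (bernF μ) (bernG μ) l k := by
  have hd : 0 < (1 - 2 * (μ l : ℝ)) ^ 2 := by
    have : 0 < 1 - 2 * (μ l : ℝ) := by linarith
    positivity
  rw [div_le_iff₀ hd] at hs
  have hle : (1 - Real.exp (-(s / 2))) ^ 2 ≤
      (1 - Real.exp (-(k * (1 - 2 * (μ l : ℝ)) ^ 2 / 2))) ^ 2 := by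
    apply pow_le_pow_left₀
    · rw [sub_nonneg, Real.exp_le_one_iff]
      linarith
    · apply sub_le_sub_left
      apply Real.exp_le_exp.2
      linarith
  exact ⟨hp.trans_le (hle.trans (le_confG μ l h0 h1 k)),
    hp.trans_le (hle.trans (le_confF μ l h0 h1 k))⟩

lemma minimalSize_spec {p : ℝ} (hp : p < 1) :
    ∃ s : ℝ, 0 ≤ s ∧ ∀ l, 0 < (μ l : ℝ) → (μ l : ℝ) < 1 / 2 →
      (p < confG (bernF μ) (bernG μ) l (minimalSize (bernF μ) (bernG μ) p (l + 1)) ∧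
        p < confF (bernF μ) (bernG μ) l (minimalSize (bernF μ) (bernG μ) p (l + 1))) ∧
      minimalSize (bernF μ) (bernG μ) p (l + 1) ≤ s / (1 - 2 * (μ l : ℝ)) ^ 2 + 1 := by
  -- Chosen so that `(1 - u)² ≥ 1 - 2u ≥ (1 + p)/2 > p`; the cap at 1 keeps `-2 log u` nonnegative.
  set u : ℝ := min 1 ((1 - p) / 4) with hu
  have hu0 : 0 < u := lt_min one_pos (by linarith)
  have hu1 : u ≤ 1 := min_le_left _ _
  have hu2 : u ≤ (1 - p) / 4 := min_le_right _ _
  have hs0 : 0 ≤ -2 * Real.log u := by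
    have := Real.log_nonpos hu0.le hu1
    linarith
  refine ⟨-2 * Real.log u, hs0, fun l h0 h1 => ?_⟩
  have hd : 0 < (1 - 2 * (μ l : ℝ)) ^ 2 := by
    have : 0 < 1 - 2 * (μ l : ℝ) := by linarith
    positivity
  have hmem : ⌈-2 * Real.log u / (1 - 2 * (μ l : ℝ)) ^ 2⌉₊ ∈
      {k | p < confG (bernF μ) (bernG μ) l k ∧ p < confF (bernF μ) (bernG μ) l k} := by
    refine lt_conf_of_lt p h0 h1 (Nat.le_ceil _) hs0 ?_
    have : -(-2 * Real.log u / 2) = Real.log u := by ring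
    rw [this, Real.exp_log hu0]
    nlinarith [sq_nonneg u]
  refine ⟨Nat.sInf_mem ⟨_, hmem⟩, ?_⟩
  have h2 : ((minimalSize (bernF μ) (bernG μ) p (l + 1) : ℕ) : ℝ)
      ≤ (⌈-2 * Real.log u / (1 - 2 * (μ l : ℝ)) ^ 2⌉₊ : ℕ) := by
    exact_mod_cast Nat.sInf_le hmem
  exact h2.trans (Nat.ceil_lt_add_one (div_nonneg hs0 hd.le)).le

lemma chernoffSize_spec {η : ℝ} (hη0 : 0 < η) (hη1 : η < 1) :
    ∃ s : ℝ, 0 ≤ s ∧ ∀ l, 0 < (μ l : ℝ) → (μ l : ℝ) < 1 / 2 →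
      (η ^ 2 < confG (bernF μ) (bernG μ) l (chernoffSize μ η (l + 1)) ∧
        η ^ 2 < confF (bernF μ) (bernG μ) l (chernoffSize μ η (l + 1))) ∧
      chernoffSize μ η (l + 1) ≤ s / (1 - 2 * (μ l : ℝ)) ^ 2 + 1 := by
  have hL : 0 < Real.log (1 / (1 - η)) := by
    apply Real.log_pos
    rw [lt_div_iff₀ (by linarith)]
    linarith
  refine ⟨12 * Real.log (1 / (1 - η)), by positivity, fun l h0 h1 => ?_⟩
  have hd : 0 < (1 - 2 * (μ l : ℝ)) ^ 2 := by
    have : 0 < 1 - 2 * (μ l : ℝ) := by linarith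
    positivity
  have hx1 : 0 < 1 - (μ l : ℝ) := by linarith
  constructor
  -- Since `1 - μ l ≥ 1/2`, the factor `12 (1 - μ l)` is at least 6; each failure probability is
  -- then at most `(1 - η)³ < 1 - η`.
  · refine lt_conf_of_lt (s := 6 * Real.log (1 / (1 - η))) _ h0 h1 ?_ (by positivity) ?_
    · refine le_trans ?_ (Nat.le_ceil _)
      gcongr
      linarith
    · have e : -(6 * Real.log (1 / (1 - η)) / 2) = (3 : ℕ) * Real.log (1 - η) := by
        rw [one_div, Real.log_inv]
        push_cast
        ring
      rw [e, Real.exp_nat_mul, Real.exp_log (by linarith)]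
      apply pow_lt_pow_left₀ _ hη0.le two_ne_zero
      have : (1 - η) ^ 3 < 1 - η := by
        have := pow_lt_pow_right_of_lt_one₀ (a := 1 - η) (by linarith) (by linarith)
          (show 1 < 3 by norm_num)
        simpa using this
      linarith
  · refine (Nat.ceil_lt_add_one (by positivity)).le.trans ?_
    gcongr
    have : (μ l : ℝ) * Real.log (1 / (1 - η)) > 0 := by positivity
    nlinarith

/-- Both choices of the local sample sizes give tests of confidence bounded away from `1 / 2`, with
`O(α ^ (2 l))` samples on level `l`. -/
lemma exists_conf_and_size_le {α : ℝ} (hα : 1 < α)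
    (hμ_pos : 0 < (μ 0 : ℝ)) (hμ_lt : (μ 0 : ℝ) < 1 / 2)
    (hμ : ∀ l : ℕ, (μ l : ℝ) = 1 / 2 - (1 / 2 - (μ 0 : ℝ)) * α ^ (-(l : ℤ)))
    {K : ℕ → ℕ}
    (hK : (∃ p ∈ Set.Ioo (1 / 2 : ℝ) 1, K = minimalSize (bernF μ) (bernG μ) p) ∨
      (∃ η ∈ Set.Ioo (1 / Real.sqrt 2) 1, K = chernoffSize μ η)) :
    (∃ p > (1 / 2 : ℝ), ∀ l : ℕ,
      p < confG (bernF μ) (bernG μ) l (K (l + 1)) ∧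
      p < confF (bernF μ) (bernG μ) l (K (l + 1))) ∧
    ∃ A : ℝ, 0 ≤ A ∧ ∀ l : ℕ, (K (l + 1) : ℝ) ≤ A * (α ^ 2) ^ (l + 1) := by
  have hα0 : 0 < α := by linarith
  have hpos : ∀ l : ℕ, 0 < α ^ (-(l : ℤ)) := fun l => zpow_pos hα0 _
  have hle1 : ∀ l : ℕ, α ^ (-(l : ℤ)) ≤ 1 := fun l =>
    zpow_le_one_of_nonpos₀ hα.le (by simp)
  have h0 : ∀ l, 0 < (μ l : ℝ) := by
    intro l
    rw [hμ l]
    nlinarith [hle1 l]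
  have h1 : ∀ l, (μ l : ℝ) < 1 / 2 := by
    intro l
    rw [hμ l]
    nlinarith [hpos l]
  have hsize : (∃ p > (1 / 2 : ℝ), ∃ s : ℝ, 0 ≤ s ∧ ∀ l,
      (p < confG (bernF μ) (bernG μ) l (K (l + 1)) ∧ p < confF (bernF μ) (bernG μ) l (K (l + 1)))
      ∧ K (l + 1) ≤ s / (1 - 2 * (μ l : ℝ)) ^ 2 + 1) := by
    rcases hK with ⟨p, ⟨hp1, hp2⟩, rfl⟩ | ⟨η, ⟨hη1, hη2⟩, rfl⟩
    · obtain ⟨s, hs, h⟩ := minimalSize_spec (μ := μ) hp2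
      exact ⟨p, hp1, s, hs, fun l => h l (h0 l) (h1 l)⟩
    · have hη0 : 0 < η := lt_trans (by positivity) hη1
      obtain ⟨s, hs, h⟩ := chernoffSize_spec (μ := μ) hη0 hη2
      refine ⟨η ^ 2, ?_, s, hs, fun l => h l (h0 l) (h1 l)⟩
      have := pow_lt_pow_left₀ hη1 (by positivity) two_ne_zero
      rwa [div_pow, Real.sq_sqrt (by norm_num), one_pow] at this
  obtain ⟨p, hp, s, hs, h⟩ := hsize
  refine ⟨⟨p, hp, fun l => (h l).1⟩, s / (1 - 2 * (μ 0 : ℝ)) ^ 2 + 1, by positivity, fun l => ?_⟩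
  refine (h l).2.trans ?_
  have hd0 : 0 < 1 - 2 * (μ 0 : ℝ) := by linarith
  have hpow : (α ^ 2) ^ l ≤ (α ^ 2) ^ (l + 1) :=
    pow_le_pow_right₀ (one_le_pow₀ hα.le) (Nat.le_succ l)
  have hone : 1 ≤ (α ^ 2) ^ (l + 1) := one_le_pow₀ (one_le_pow₀ hα.le)
  -- The signal `1 - 2 μ l` decays like `α^(-l)`, so a test costs of order `α^(2l)`.
  have hd : (1 - 2 * (μ l : ℝ)) ^ 2 = (1 - 2 * (μ 0 : ℝ)) ^ 2 / (α ^ 2) ^ l := by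
    have : 1 - 2 * (μ l : ℝ) = (1 - 2 * (μ 0 : ℝ)) / α ^ l := by
      rw [hμ l, zpow_neg, zpow_natCast]
      field_simp
      ring
    rw [this, div_pow, ← pow_mul, ← pow_mul, mul_comm l 2]
  rw [hd, add_mul, one_mul, div_div_eq_mul_div, ← div_mul_eq_mul_div]
  exact add_le_add (mul_le_mul_of_nonneg_left hpow (by positivity)) hone

end Sizes

/-! ### The distance to the target in the tree -/

/-- The distance from `v` to the leaf `m`, provided an ancestor of `v` at most `k` levels above
contains `m`. -/
def distAux (m : ℕ) : ℕ → Node → ℕ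
  | 0, v => v.1
  | k + 1, v => if m / 2 ^ v.1 = v.2 then v.1 else distAux m k (v.1 + 1, v.2 / 2) + 1

/-- The distance from the node `v` to the leaf `m` in the tree of height `n`. -/
def targetDist (n m : ℕ) (v : Node) : ℕ := distAux m (n - v.1) v

/-- `v` is a node of the tree of height `n`. -/
def InTree (n : ℕ) (v : Node) : Prop := v.1 ≤ n ∧ v.2 < 2 ^ (n - v.1)

section Tree

variable {n m l i : ℕ} {v : Node}

lemma inTree_root (n : ℕ) : InTree n (n, 0) := by simp [InTree]

lemma InTree.parent (hv : InTree n v) : InTree n (parent n v) := by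
  unfold TreeSearch.parent
  split_ifs with h
  · exact hv
  · obtain ⟨h1, h2⟩ := hv
    have e : n - v.1 = n - (v.1 + 1) + 1 := by omega
    rw [e, pow_succ] at h2
    exact ⟨by show v.1 + 1 ≤ n; omega, by show v.2 / 2 < 2 ^ (n - (v.1 + 1)); omega⟩

lemma InTree.child (hv : InTree n (l + 1, i)) {j : ℕ} (hj : j / 2 = i) : InTree n (l, j) := by
  obtain ⟨h1, h2⟩ := hv
  simp only at h1 h2
  have e : n - l = n - (l + 1) + 1 := by omega
  refine ⟨by show l ≤ n; omega, ?_⟩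
  show j < 2 ^ (n - l)
  rw [e, pow_succ]
  omega

lemma InTree.parent_child (hv : InTree n (l + 1, i)) {j : ℕ} (hj : j / 2 = i) :
    TreeSearch.parent n (l, j) = (l + 1, i) := by
  have h1 : l + 1 ≤ n := hv.1
  have : l ≠ n := by omega
  simp [TreeSearch.parent, this, hj]

lemma contains_of_level_eq (hm : m < 2 ^ n) (hv : InTree n v) (h : v.1 = n) : Contains v m := by
  obtain ⟨h1, h2⟩ := hv
  simp only [h, Nat.sub_self, pow_zero, Nat.lt_one_iff] at h2
  rw [Contains, h, h2, Nat.div_eq_of_lt hm]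

lemma Contains.succ {j : ℕ} (h : Contains (l, j) m) : Contains (l + 1, j / 2) m := by
  simp only [Contains] at h ⊢
  rw [pow_succ, ← Nat.div_div_eq_div_mul, h]

lemma Contains.child_or (h : Contains (l + 1, i) m) :
    Contains (l, 2 * i) m ∧ ¬ Contains (l, 2 * i + 1) m ∨
      Contains (l, 2 * i + 1) m ∧ ¬ Contains (l, 2 * i) m := by
  simp only [Contains] at h ⊢
  rw [pow_succ, ← Nat.div_div_eq_div_mul] at h
  omega

lemma targetDist_of_contains (h : Contains v m) : targetDist n m v = v.1 := by
  unfold targetDist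
  cases n - v.1 with
  | zero => rfl
  | succ k => rw [distAux, if_pos (show m / 2 ^ v.1 = v.2 from h)]

lemma targetDist_of_not_contains (hm : m < 2 ^ n) (hv : InTree n v) (h : ¬ Contains v m) :
    targetDist n m v = targetDist n m (parent n v) + 1 := by
  have hne : v.1 ≠ n := fun he => h (contains_of_level_eq hm hv he)
  have hlt : v.1 < n := lt_of_le_of_ne hv.1 hne
  rw [parent, if_neg hne]
  unfold targetDist
  have e : n - v.1 = n - (v.1 + 1) + 1 := by omega
  rw [e, distAux, if_neg (show ¬ m / 2 ^ v.1 = v.2 from h)]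

lemma targetDist_parent_le (hm : m < 2 ^ n) (hv : InTree n v) :
    targetDist n m (parent n v) ≤ targetDist n m v + 1 := by
  by_cases h : Contains v m
  · by_cases hn : v.1 = n
    · simp [parent, hn]
    · rw [parent, if_neg hn, targetDist_of_contains h]
      have h' : Contains (v.1 + 1, v.2 / 2) m := Contains.succ (l := v.1) (j := v.2) h
      rw [targetDist_of_contains h']
  · rw [targetDist_of_not_contains hm hv h]
    omega

lemma targetDist_child_le (hm : m < 2 ^ n) (hv : InTree n (l + 1, i)) {j : ℕ} (hj : j / 2 = i) :
    targetDist n m (l, j) ≤ targetDist n m (l + 1, i) + 1 := by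
  by_cases h : Contains (l, j) m
  · have h' : Contains (l + 1, i) m := hj ▸ h.succ
    rw [targetDist_of_contains h, targetDist_of_contains h']
    show l ≤ l + 1 + 1
    omega
  · rw [targetDist_of_not_contains hm (hv.child hj) h, hv.parent_child hj]

lemma targetDist_child_of_contains {j : ℕ} (hj : j / 2 = i)
    (h : Contains (l, j) m) : targetDist n m (l, j) + 1 = targetDist n m (l + 1, i) := by
  have h' : Contains (l + 1, i) m := hj ▸ h.succ
  rw [targetDist_of_contains h, targetDist_of_contains h']

/-- If the first ancestor containing the target is on level `a`, the path climbs `a - l` and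
descends `a`, so `d = 2a - l` with `l ≤ a ≤ n`. This bounds the price of a node by a function of its
distance alone. -/
lemma le_targetDist_and_add_le (hm : m < 2 ^ n) (hv : InTree n v) :
    v.1 ≤ targetDist n m v ∧ targetDist n m v + v.1 ≤ 2 * n := by
  induction hk : n - v.1 generalizing v with
  | zero =>
    have := hv.1
    rw [targetDist_of_contains (contains_of_level_eq hm hv (by omega))]
    omega
  | succ k ih =>
  by_cases h : Contains v m
  · have := hv.1
    rw [targetDist_of_contains h]
    omega
  · have hne : v.1 ≠ n := fun he => h (contains_of_level_eq hm hv he)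
    have hlt : v.1 < n := lt_of_le_of_ne hv.1 hne
    have hp : (parent n v).1 = v.1 + 1 := by rw [parent, if_neg hne]
    have ih := ih hv.parent (by omega)
    rw [targetDist_of_not_contains hm hv h]
    omega

end Tree

/-! ### The potential of a biased walk on the line -/

/-- Increments of the potential, as a function of the distance to the right end. -/
noncomputable def incr (p : ℝ) (w : ℕ → ℝ) : ℕ → ℝ
  | 0 => 0
  -- This solves `p ΔW(d-1) = w + (1 - p) ΔW(d)`, the balance equation of the walk, starting from a
  -- flat potential beyond the right end.
  | k + 1 => (w k + (1 - p) * incr p w k) / p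

section Incr

variable {p : ℝ} {w : ℕ → ℝ}

lemma incr_nonneg (hp0 : 0 ≤ p) (hp1 : p ≤ 1) (hw : ∀ k, 0 ≤ w k) (k : ℕ) : 0 ≤ incr p w k := by
  induction k with
  | zero => exact le_rfl
  | succ k ih =>
    exact div_nonneg (add_nonneg (hw k) (mul_nonneg (by linarith) ih)) hp0

/-- Summing the recursion gives `p S ≤ ∑ w + (1 - p) S` for the total `S`. -/
lemma sum_incr_le (hp0 : 1 / 2 < p) (hp1 : p ≤ 1) (hw : ∀ k, 0 ≤ w k) (N : ℕ) :
    (2 * p - 1) * ∑ k ∈ Finset.range (N + 1), incr p w k ≤ ∑ k ∈ Finset.range N, w k := by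
  have hp : 0 < p := by linarith
  have h1 : ∑ k ∈ Finset.range (N + 1), incr p w k = ∑ k ∈ Finset.range N, incr p w (k + 1) := by
    rw [Finset.sum_range_succ', incr, add_zero]
  have h2 : p * ∑ k ∈ Finset.range N, incr p w (k + 1)
      = ∑ k ∈ Finset.range N, w k + (1 - p) * ∑ k ∈ Finset.range N, incr p w k := by
    rw [Finset.mul_sum, Finset.mul_sum, ← Finset.sum_add_distrib]
    refine Finset.sum_congr rfl fun k _ => ?_
    rw [incr, mul_div_cancel₀ _ hp.ne']
  have h3 : ∑ k ∈ Finset.range N, incr p w k ≤ ∑ k ∈ Finset.range (N + 1), incr p w k := by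
    rw [Finset.sum_range_succ]
    linarith [incr_nonneg hp.le hp1 hw N]
  have h4 := mul_le_mul_of_nonneg_left h3 (show 0 ≤ 1 - p by linarith)
  rw [← h1] at h2
  nlinarith

end Incr

lemma sum_pow_min_le {β : ℝ} (hβ : 1 < β) (n : ℕ) :
    ∑ k ∈ Finset.range (2 * n), β ^ min k (2 * n - k) ≤ (1 + β) / (β - 1) * β ^ n := by
  have h1 : ∑ k ∈ Finset.range (2 * n), β ^ min k (2 * n - k)
      = ∑ k ∈ Finset.range n, β ^ k + ∑ k ∈ Finset.range n, β * β ^ k := by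
    rw [two_mul, Finset.sum_range_add]
    congr 1
    · refine Finset.sum_congr rfl fun k hk => ?_
      have := Finset.mem_range.1 hk
      congr 1
      omega
    · rw [← Finset.sum_range_reflect]
      refine Finset.sum_congr rfl fun k hk => ?_
      have := Finset.mem_range.1 hk
      rw [← pow_succ']
      congr 1
      omega
  have hb : 0 < β - 1 := by linarith
  rw [h1, ← Finset.mul_sum, geom_sum_eq hβ.ne']
  have e : (β ^ n - 1) / (β - 1) + β * ((β ^ n - 1) / (β - 1))
      = (1 + β) / (β - 1) * (β ^ n - 1) := by ring
  rw [e]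
  gcongr
  linarith

/-- A walk on `{0, …, 2 n}` which moves left with probability at least `p > 1 / 2` and pays
`A * β ^ min d (2 n - d)` at `d` has a potential which is `O(β ^ n)` up to `n`. -/
lemma exists_potential {p β A : ℝ} (hp0 : 1 / 2 < p) (hp1 : p ≤ 1) (hβ : 1 < β) (hA : 0 ≤ A) :
    ∃ B : ℝ, 0 ≤ B ∧ ∀ n : ℕ, ∃ W : ℕ → ℝ, W 0 = 0 ∧ Monotone W ∧
      (∀ d, 1 ≤ d → d ≤ 2 * n →
        A * β ^ min d (2 * n - d) + p * W (d - 1) + (1 - p) * W (d + 1) ≤ W d) ∧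
      W 1 ≤ B * β ^ n ∧ W n ≤ B * β ^ n := by
  have hβ0 : 0 < β - 1 := by linarith
  have h2p : 0 < 2 * p - 1 := by linarith
  have hp : 0 < p := by linarith
  have hβ1 : 0 < 1 + β := by linarith
  refine ⟨A * ((1 + β) / (β - 1)) / (2 * p - 1), by positivity, fun n => ?_⟩
  set w : ℕ → ℝ := fun k => A * β ^ min k (2 * n - k) with hw
  have hw0 : ∀ k, 0 ≤ w k := fun k => mul_nonneg hA (pow_nonneg (by linarith) _)
  have hi0 := incr_nonneg hp.le hp1 hw0
  -- Truncated subtraction makes the increments vanish for `i ≥ 2n`, so `W` is constant there.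
  set W : ℕ → ℝ := fun d => ∑ i ∈ Finset.range d, incr p w (2 * n - i) with hW
  have hmono : Monotone W := monotone_nat_of_le_succ fun d => by
    simp only [hW, Finset.sum_range_succ]
    linarith [hi0 (2 * n - d)]
  have hbound : ∀ d ≤ 2 * n + 1, W d ≤ A * ((1 + β) / (β - 1)) / (2 * p - 1) * β ^ n := by
    intro d hd
    have h1 : W (2 * n + 1) = ∑ k ∈ Finset.range (2 * n + 1), incr p w k := by
      rw [← Finset.sum_range_reflect]
      refine Finset.sum_congr rfl fun k hk => ?_
      congr 1
    have h2 := sum_incr_le hp0 hp1 hw0 (2 * n)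
    have h3 : ∑ k ∈ Finset.range (2 * n), w k ≤ A * ((1 + β) / (β - 1) * β ^ n) := by
      rw [hw, ← Finset.mul_sum]
      exact mul_le_mul_of_nonneg_left (sum_pow_min_le hβ n) hA
    refine (hmono hd).trans ?_
    rw [h1, div_mul_eq_mul_div, le_div_iff₀ h2p]
    linarith
  refine ⟨W, by simp [hW], hmono, ?_, hbound 1 (by omega), hbound n (by omega)⟩
  intro d hd1 hd2
  obtain ⟨e, rfl⟩ : ∃ e, d = e + 1 := ⟨d - 1, by omega⟩
  have h1 : W (e + 1) = W e + incr p w (2 * n - e) := by simp only [hW, Finset.sum_range_succ]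
  have h2 : W (e + 1 + 1) = W (e + 1) + incr p w (2 * n - (e + 1)) := by
    simp only [hW, Finset.sum_range_succ]
  have h3 : p * incr p w (2 * n - e)
      = w (2 * n - (e + 1)) + (1 - p) * incr p w (2 * n - (e + 1)) := by
    have : 2 * n - e = 2 * n - (e + 1) + 1 := by omega
    rw [this, incr, mul_div_cancel₀ _ hp.ne']
  have h4 : w (2 * n - (e + 1)) = A * β ^ min (e + 1) (2 * n - (e + 1)) := by
    simp only [hw]
    congr 2
    omega
  rw [h4] at h3
  simp only [Nat.add_sub_cancel]
  rw [h2, h1]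
  nlinarith

/-! ### Averages over future observations -/

/-- The average of `F` over the history obtained from `b` by appending `k` observations with
distribution `w`. -/
noncomputable def avg (w : Bool → ℝ) : ℕ → (List Bool → ℝ) → List Bool → ℝ
  | 0, F, b => F b
  | k + 1, F, b => ∑ y, w y * avg w k F (y :: b)

lemma avg_eq_sum (w : Bool → ℝ) (k : ℕ) (F : List Bool → ℝ) (b : List Bool) :
    avg w k F b = ∑ x : Fin k → Bool, (∏ i, w (x i)) * F (List.ofFn x ++ b) := by
  induction k generalizing b with
  | zero => simp [avg]
  | succ k ih =>
    -- Lists have the newest observation first, so the first draw of `avg` is the last coordinate of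
    -- `x`.
    rw [avg, ← (Fin.snocEquiv fun _ => Bool).sum_comp, Fintype.sum_prod_type]
    refine Finset.sum_congr rfl fun y _ => ?_
    rw [ih, Finset.mul_sum]
    refine Finset.sum_congr rfl fun x _ => ?_
    rw [Fin.prod_univ_castSucc, List.ofFn_succ']
    simp [Fin.snocEquiv]
    ring

lemma avg_nonneg {w : Bool → ℝ} (hw : ∀ y, 0 ≤ w y) {F : List Bool → ℝ} (hF : ∀ b, 0 ≤ F b)
    (k : ℕ) (b : List Bool) : 0 ≤ avg w k F b := by
  rw [avg_eq_sum]
  exact Finset.sum_nonneg fun x _ => mul_nonneg (Finset.prod_nonneg fun i _ => hw _) (hF _)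

lemma avg_avg_eq_integral (ν₁ ν₂ : Measure Bool) [IsProbabilityMeasure ν₁]
    [IsProbabilityMeasure ν₂] (k : ℕ) (F : List Bool → ℝ) :
    avg (fun y => ν₁.real {y}) k (avg (fun y => ν₂.real {y}) k F) []
      = ∫ x, F (List.ofFn x.2 ++ List.ofFn x.1)
          ∂((Measure.pi fun _ : Fin k => ν₁).prod (Measure.pi fun _ : Fin k => ν₂)) := by
  rw [integral_fintype Integrable.of_finite, Fintype.sum_prod_type, avg_eq_sum]
  refine Finset.sum_congr rfl fun x _ => ?_
  rw [avg_eq_sum, Finset.mul_sum]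
  refine Finset.sum_congr rfl fun z _ => ?_
  have e1 : ∀ (ν : Measure Bool) [IsProbabilityMeasure ν] (x : Fin k → Bool),
      (Measure.pi fun _ : Fin k => ν).real {x} = ∏ i, ν.real {x i} := by
    intro ν _ x
    rw [measureReal_def, Measure.pi_singleton, ENNReal.toReal_prod]
    rfl
  rw [← Set.singleton_prod_singleton, measureReal_prod_prod, e1, e1, smul_eq_mul, List.append_nil]
  ring

/-- A two-sample average of a function bounded by `hi`, and by `lo` on an event of probability at
least `p`. -/
lemma avg_avg_le (ν₁ ν₂ : Measure Bool) [IsProbabilityMeasure ν₁] [IsProbabilityMeasure ν₂]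
    {k : ℕ} {F : List Bool → ℝ} {S : Set ((Fin k → Bool) × (Fin k → Bool))} {lo hi p : ℝ}
    (hlo : lo ≤ hi) (hF : ∀ b, F b ≤ hi)
    (hS : ∀ x ∈ S, F (List.ofFn x.2 ++ List.ofFn x.1) ≤ lo)
    (hp : p ≤ ((Measure.pi fun _ : Fin k => ν₁).prod (Measure.pi fun _ : Fin k => ν₂)).real S) :
    avg (fun y => ν₁.real {y}) k (avg (fun y => ν₂.real {y}) k F) [] ≤ p * lo + (1 - p) * hi := by
  classical
  rw [avg_avg_eq_integral]
  set P := (Measure.pi fun _ : Fin k => ν₁).prod (Measure.pi fun _ : Fin k => ν₂)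
  have h1 : ∫ x, F (List.ofFn x.2 ++ List.ofFn x.1) ∂P
      ≤ ∫ x, (hi - S.indicator (fun _ => hi - lo) x) ∂P := by
    refine integral_mono Integrable.of_finite Integrable.of_finite fun x => ?_
    by_cases hx : x ∈ S
    · simpa [hx] using hS x hx
    · simpa [hx] using hF _
  rw [integral_sub Integrable.of_finite Integrable.of_finite,
    integral_indicator_const _ MeasurableSet.of_discrete] at h1
  simp only [integral_const, probReal_univ, smul_eq_mul] at h1
  have h2 := mul_le_mul_of_nonneg_right hp (sub_nonneg.2 hlo)
  linarith

lemma sllr_cons (f g : ℕ → Measure Bool) (l : ℕ) (y : Bool) (b : List Bool) :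
    sllr f g l (y :: b) = llr f g l y + sllr f g l b := by
  simp [sllr]

lemma sllr_ofFn (f g : ℕ → Measure Bool) (l : ℕ) {k : ℕ} (x : Fin k → Bool) :
    sllr f g l (List.ofFn x) = ∑ n, llr f g l (x n) := by
  simp [sllr, List.map_ofFn, List.sum_ofFn]

/-! ### The moves of the walk -/

section Moves

variable (f g : ℕ → Measure Bool) (K : ℕ → ℕ) (tie : Node → Prop) (n : ℕ) (c : ℝ)

open Classical in
/-- The node to which the walk moves from `(l + 1, i)` when the samples `b` have been collected. -/
noncomputable def nextNode (l i : ℕ) (b : List Bool) : Node :=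
  if sllr f g l (b.drop (K (l + 1))) < 0 ∧ sllr f g l (b.take (K (l + 1))) < 0 then
    parent n (l + 1, i)
  else if sllr f g l (b.take (K (l + 1))) < sllr f g l (b.drop (K (l + 1))) ∨
      (sllr f g l (b.take (K (l + 1))) = sllr f g l (b.drop (K (l + 1))) ∧ tie (l + 1, i)) then
    (l, 2 * i)
  else (l, 2 * i + 1)

lemma walkStep_succ (l i : ℕ) (b : List Bool) (d : Prop) (y : Bool) :
    walkStep f g K tie n c ⟨(l + 1, i), b, d⟩ y =
      if b.length + 1 < 2 * K (l + 1) then ⟨(l + 1, i), y :: b, d⟩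
      else ⟨nextNode f g K tie n l i (y :: b), [], d⟩ := by
  simp only [walkStep, nextNode, List.length_cons]
  split_ifs <;> rfl

lemma nextNode_cases (l i : ℕ) (b : List Bool) :
    nextNode f g K tie n l i b = parent n (l + 1, i) ∨
      ∃ j, j / 2 = i ∧ nextNode f g K tie n l i b = (l, j) := by
  unfold nextNode
  split_ifs
  · exact Or.inl rfl
  · exact Or.inr ⟨2 * i, by omega, rfl⟩
  · exact Or.inr ⟨2 * i + 1, by omega, rfl⟩

variable {n}

lemma InTree.nextNode {l i : ℕ} (hv : InTree n (l + 1, i)) (b : List Bool) :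
    InTree n (nextNode f g K tie n l i b) := by
  rcases nextNode_cases f g K tie n l i b with h | ⟨j, hj, h⟩
  · rw [h]
    exact hv.parent
  · rw [h]
    exact hv.child hj

lemma targetDist_nextNode_le {m l i : ℕ} (hm : m < 2 ^ n) (hv : InTree n (l + 1, i))
    (b : List Bool) :
    targetDist n m (nextNode f g K tie n l i b) ≤ targetDist n m (l + 1, i) + 1 := by
  rcases nextNode_cases f g K tie n l i b with h | ⟨j, hj, h⟩
  · rw [h]
    exact targetDist_parent_le hm hv
  · rw [h]
    exact targetDist_child_le hm hv hj

variable {f g} in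
/-- On a test of confidence greater than `p`, the average of a monotone function of the distance of
the next node to the target. -/
lemma avg_nextNode_le [∀ l, IsProbabilityMeasure (f l)] [∀ l, IsProbabilityMeasure (g l)]
    {m l i : ℕ} (hm : m < 2 ^ n) (hv : InTree n (l + 1, i)) {p : ℝ}
    (hpG : p < confG f g l (K (l + 1))) (hpF : p < confF f g l (K (l + 1)))
    {V : ℕ → ℝ} (hV : Monotone V) :
    avg (fun y => (nodeLaw f g m (l, 2 * i)).real {y}) (K (l + 1))
      (avg (fun y => (nodeLaw f g m (l, 2 * i + 1)).real {y}) (K (l + 1))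
        fun b => V (targetDist n m (nextNode f g K tie n l i b))) []
      ≤ p * V (targetDist n m (l + 1, i) - 1) + (1 - p) * V (targetDist n m (l + 1, i) + 1) := by
  have hlo : V (targetDist n m (l + 1, i) - 1) ≤ V (targetDist n m (l + 1, i) + 1) :=
    hV (by omega)
  have hF : ∀ b, V (targetDist n m (nextNode f g K tie n l i b))
      ≤ V (targetDist n m (l + 1, i) + 1) :=
    fun b => hV (targetDist_nextNode_le f g K tie hm hv b)
  have htake : ∀ x : (Fin (K (l + 1)) → Bool) × (Fin (K (l + 1)) → Bool),
      sllr f g l ((List.ofFn x.2 ++ List.ofFn x.1).take (K (l + 1)))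
        = ∑ n, llr f g l (x.2 n) := by
    intro x
    rw [List.take_left' (List.length_ofFn), sllr_ofFn]
  have hdrop : ∀ x : (Fin (K (l + 1)) → Bool) × (Fin (K (l + 1)) → Bool),
      sllr f g l ((List.ofFn x.2 ++ List.ofFn x.1).drop (K (l + 1)))
        = ∑ n, llr f g l (x.1 n) := by
    intro x
    rw [List.drop_left' (List.length_ofFn), sllr_ofFn]
  by_cases hc : Contains (l + 1, i) m
  · rcases hc.child_or with ⟨h1, h2⟩ | ⟨h1, h2⟩
    · have e1 : nodeLaw f g m (l, 2 * i) = g l := by rw [nodeLaw, if_pos h1]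
      have e2 : nodeLaw f g m (l, 2 * i + 1) = f l := by rw [nodeLaw, if_neg h2]
      rw [e1, e2]
      refine avg_avg_le (g l) (f l) hlo hF ?_ hpG.le
      intro x hx
      have hx' : max (∑ n, llr f g l (x.2 n)) 0 < ∑ n, llr f g l (x.1 n) := hx
      have hx1 := (le_max_left _ _).trans_lt hx'
      have hx2 := (le_max_right _ _).trans_lt hx'
      rw [nextNode, htake, hdrop, if_neg (fun h => absurd h.1 hx2.le.not_gt),
        if_pos (Or.inl hx1), ← targetDist_child_of_contains (by omega) h1]
      simp
    · have e1 : nodeLaw f g m (l, 2 * i) = f l := by rw [nodeLaw, if_neg h2]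
      have e2 : nodeLaw f g m (l, 2 * i + 1) = g l := by rw [nodeLaw, if_pos h1]
      rw [e1, e2]
      refine avg_avg_le (S := {x | max (∑ n, llr f g l (x.1 n)) 0 < ∑ n, llr f g l (x.2 n)})
        (f l) (g l) hlo hF ?_ ?_
      · intro x hx
        have hx' : max (∑ n, llr f g l (x.1 n)) 0 < ∑ n, llr f g l (x.2 n) := hx
        have hx1 := (le_max_left _ _).trans_lt hx'
        have hx2 := (le_max_right _ _).trans_lt hx'
        rw [nextNode, htake, hdrop, if_neg (fun h => absurd h.2 hx2.le.not_gt),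
          if_neg (by rintro (h | h); exacts [lt_asymm h hx1, hx1.ne' h.1]),
          ← targetDist_child_of_contains (by omega) h1]
        simp
      -- `confG` puts the target child first; here it is the right child, so the two factors are
      -- swapped.
      · refine hpG.le.trans (le_of_eq ?_)
        rw [confG, ← Measure.prod_swap, measureReal_def, measureReal_def,
          Measure.map_apply measurable_swap MeasurableSet.of_discrete]
        rfl
  · have h1 : ¬ Contains (l, 2 * i) m := fun h => hc (by
      have := h.succ
      rwa [show 2 * i / 2 = i by omega] at this)
    have h2 : ¬ Contains (l, 2 * i + 1) m := fun h => hc (by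
      have := h.succ
      rwa [show (2 * i + 1) / 2 = i by omega] at this)
    have e1 : nodeLaw f g m (l, 2 * i) = f l := by rw [nodeLaw, if_neg h1]
    have e2 : nodeLaw f g m (l, 2 * i + 1) = f l := by rw [nodeLaw, if_neg h2]
    rw [e1, e2]
    refine avg_avg_le (S := {z | ∑ n, llr f g l (z n) < 0} ×ˢ {z | ∑ n, llr f g l (z n) < 0})
      (f l) (f l) hlo hF ?_ ?_
    · rintro x ⟨hx1, hx2⟩
      have hx1' : ∑ n, llr f g l (x.1 n) < 0 := hx1
      have hx2' : ∑ n, llr f g l (x.2 n) < 0 := hx2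
      rw [nextNode, htake, hdrop, if_pos ⟨hx1', hx2'⟩, targetDist_of_not_contains hm hv hc]
      simp
    · rw [measureReal_prod_prod, ← sq]
      exact hpF.le

end Moves

/-! ### The potential of the information-directed random walk -/

/-- The stopping threshold of the test at a leaf. -/
noncomputable def threshold (n : ℕ) (c : ℝ) : ℝ := Real.log (Real.logb 2 (2 ^ n) / c)

lemma logb_two_pow (n : ℕ) : Real.logb 2 (2 ^ n) = n := by
  rw [Real.logb_pow, Real.logb_self_eq_one (by norm_num), mul_one]

lemma exp_threshold {n : ℕ} (hn : 1 ≤ n) {c : ℝ} (hc : 0 < c) :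
    Real.exp (threshold n c) = n / c := by
  have : (0 : ℝ) < n := by exact_mod_cast hn
  rw [threshold, logb_two_pow, Real.exp_log (by positivity)]

lemma threshold_pos {n : ℕ} (hn : 1 ≤ n) {c : ℝ} (hc : 0 < c) (hc1 : c < 1) :
    0 < threshold n c := by
  have : (1 : ℝ) ≤ n := by exact_mod_cast hn
  rw [threshold, logb_two_pow]
  apply Real.log_pos
  rw [lt_div_iff₀ hc]
  linarith

/-- `V d` bounds the remaining cost, in samples, of a walk which arrives at a node at distance `d`
from the target; `E` is the part due to the possibility of leaving the target leaf again. -/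
structure IsPotential (μ : ℕ → unitInterval) (K : ℕ → ℕ) (n : ℕ) (c p E : ℝ) (V : ℕ → ℝ) :
    Prop where
  mono : Monotone V
  nonneg : 0 ≤ E
  zero : V 0 = (threshold n c + llrStep μ 0) / ((1 - 2 * μ 0) * llrStep μ 0) + E
  -- A retreat from the target leaf happens at `exp (-S) = (1 - μ 0) / μ 0`; the growth of `E exp
  -- (-S)` from its value at `S = 0` must pay for the return.
  one : V 1 ≤ V 0 + E * ((1 - μ 0) / μ 0 - 1)
  leaf : ∀ d, 1 ≤ d → d ≤ 2 * n → 1 / (1 - 2 * μ 0) + 1 + V (d - 1) ≤ V d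
  interior : ∀ l d, l + 1 ≤ d → d + (l + 1) ≤ 2 * n →
    2 * K (l + 1) + p * V (d - 1) + (1 - p) * V (d + 1) ≤ V d

section Potential

variable (μ : ℕ → unitInterval) (K : ℕ → ℕ) (tie : Node → Prop) (n : ℕ) (c : ℝ) (m : ℕ)
  (E : ℝ) (V : ℕ → ℝ)

/-- Potential at the leaf `i`, where the current sum of log-likelihood ratios is `S`. -/
noncomputable def leafPotential (i : ℕ) (S : ℝ) : ℝ :=
  if i = m then
    -- The extra `llrStep μ 0` absorbs the overshoot of the threshold by at most one step.
    c * ((threshold n c + llrStep μ 0 - S) / ((1 - 2 * μ 0) * llrStep μ 0) + E * Real.exp (-S))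
  else
    -- `S / llrStep μ 0 + 1` is the number of net downward steps before a retreat, each taking `1 /
    -- (1 - 2 μ 0)` samples on average.
    c * ((S / llrStep μ 0 + 1) * (1 / (1 - 2 * μ 0)) + Real.exp S / n
      + V (targetDist n m (0, i) - 1))

/-- The average of `V` after the next move from `(l + 1, i)`, given the samples `b` collected so
far. -/
noncomputable def moveAverage (l i : ℕ) (b : List Bool) : ℝ :=
  if b.length < K (l + 1) then
    avg (fun y => (nodeLaw (bernF μ) (bernG μ) m (l, 2 * i)).real {y}) (K (l + 1) - b.length)
      (avg (fun y => (nodeLaw (bernF μ) (bernG μ) m (l, 2 * i + 1)).real {y}) (K (l + 1))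
        fun b => V (targetDist n m (nextNode (bernF μ) (bernG μ) K tie n l i b))) b
  else
    avg (fun y => (nodeLaw (bernF μ) (bernG μ) m (l, 2 * i + 1)).real {y})
      (2 * K (l + 1) - b.length)
      (fun b => V (targetDist n m (nextNode (bernF μ) (bernG μ) K tie n l i b))) b

open Classical in
/-- Potential of a state of the walk: a bound on the probability of a wrong declaration plus `c`
times the expected number of further samples. -/
noncomputable def statePotential (s : WalkState) : ℝ :=
  if s.done then (if s.node.2 = m then 0 else 1)
  else
    match s.node with
    | (0, i) => leafPotential μ n c m E V i (sllr (bernF μ) (bernG μ) 0 s.buffer)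
    | (l + 1, i) => c * (2 * K (l + 1) - s.buffer.length + moveAverage μ K tie n m V l i s.buffer)

/-- Invariant of the states of the walk. -/
def Valid (s : WalkState) : Prop :=
  InTree n s.node ∧ (¬ s.done →
    -- The lattice structure of `S` ensures that a retreat occurs exactly at `-llrStep μ 0`.
    (s.node.1 = 0 → ∃ z : ℕ, sllr (bernF μ) (bernG μ) 0 s.buffer = z * llrStep μ 0 ∧
      z * llrStep μ 0 ≤ threshold n c) ∧
    ∀ l, s.node.1 = l + 1 → s.buffer.length < 2 * K (l + 1))

variable {μ K n c m E V}

lemma valid_nil (hK : ∀ l, 1 ≤ K (l + 1)) (hn : 1 ≤ n) (hc : 0 < c) (hc1 : c < 1) {v : Node}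
    (hv : InTree n v) (d : Prop) : Valid μ K n c ⟨v, [], d⟩ := by
  refine ⟨hv, fun _ => ⟨fun _ => ⟨0, ?_, ?_⟩, fun l _ => ?_⟩⟩
  · simp [sllr]
  · simpa using (threshold_pos hn hc hc1).le
  · have := hK l
    simp
    omega

lemma valid_walkStep (h0 : 0 < (μ 0 : ℝ)) (h1 : (μ 0 : ℝ) < 1 / 2)
    (hK : ∀ l, 1 ≤ K (l + 1)) (hn : 1 ≤ n) (hc : 0 < c) (hc1 : c < 1) {s : WalkState}
    (hs : Valid μ K n c s) (y : Bool) :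
    Valid μ K n c (walkStep (bernF μ) (bernG μ) K tie n c s y) := by
  have hL := llrStep_pos μ 0 h0 h1
  obtain ⟨⟨_ | l, i⟩, b, d⟩ := s
  · obtain ⟨htree, hbuf⟩ := hs
    simp only [walkStep]
    split_ifs with h2 h3
    · exact valid_nil hK hn hc hc1 htree.parent d
    · exact ⟨htree, fun h => absurd trivial h⟩
    · refine ⟨htree, fun hd => ⟨fun _ => ?_, fun l hl => absurd hl (by simp)⟩⟩
      obtain ⟨z, hz, hz'⟩ := (hbuf hd).1 rfl
      simp only at hz
      rw [← threshold, not_lt] at h3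
      simp only [sllr_cons, hz, not_lt] at h2 h3 ⊢
      cases y with
      | true =>
        refine ⟨z + 1, ?_, ?_⟩
        · rw [llr_true]
          push_cast
          ring
        · rw [llr_true] at h3
          push_cast
          linarith
      | false =>
        rw [llr_false] at h2 h3 ⊢
        cases z with
        | zero =>
          simp only [Nat.cast_zero, zero_mul, add_zero] at h2
          linarith
        | succ z =>
          refine ⟨z, ?_, ?_⟩
          · push_cast
            ring
          · push_cast at h3
            linarith
  · rw [walkStep_succ]
    split_ifs with h
    · refine ⟨hs.1, fun _ => ⟨fun h => absurd h (by simp), fun l' hl => ?_⟩⟩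
      obtain rfl : l = l' := by simpa using hl
      simpa using h
    · exact valid_nil hK hn hc hc1 (InTree.nextNode _ _ _ _ hs.1 _) d

lemma valid_walkState (h0 : 0 < (μ 0 : ℝ)) (h1 : (μ 0 : ℝ) < 1 / 2)
    (hK : ∀ l, 1 ≤ K (l + 1)) (hn : 1 ≤ n) (hc : 0 < c) (hc1 : c < 1) (h : List Bool) :
    Valid μ K n c (walkState (bernF μ) (bernG μ) K tie n c h) := by
  induction h with
  | nil => exact valid_nil hK hn hc hc1 (inTree_root n) False
  | cons y h ih => exact valid_walkStep tie h0 h1 hK hn hc hc1 ih y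

/-! #### Averages of the potential over one observation -/

/-- The tower property: averaging over the next sample leaves the prediction of the next move
unchanged. -/
lemma sum_moveAverage {l i : ℕ} {b : List Bool} (hb : b.length < 2 * K (l + 1)) (d : Prop) :
    ∑ y, (nodeLaw (bernF μ) (bernG μ) m (probe K ⟨(l + 1, i), b, d⟩)).real {y}
        * moveAverage μ K tie n m V l i (y :: b)
      = moveAverage μ K tie n m V l i b := by
  by_cases h : b.length < K (l + 1)
  · have hp : probe K ⟨(l + 1, i), b, d⟩ = (l, 2 * i) := by simp [probe, h]
    have e : K (l + 1) - b.length = K (l + 1) - (b.length + 1) + 1 := by omega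
    rw [hp]
    conv_rhs => rw [moveAverage, if_pos h, e, avg]
    refine Finset.sum_congr rfl fun y _ => ?_
    congr 1
    rw [moveAverage, List.length_cons]
    split_ifs with h'
    · rfl
    -- At the switch from the left to the right child the two branches of `moveAverage` agree.
    · have e1 : K (l + 1) - (b.length + 1) = 0 := by omega
      have e2 : 2 * K (l + 1) - (b.length + 1) = K (l + 1) := by omega
      rw [e1, e2]
      rfl
  · have hp : probe K ⟨(l + 1, i), b, d⟩ = (l, 2 * i + 1) := by simp [probe, h]
    have e : 2 * K (l + 1) - b.length = 2 * K (l + 1) - (b.length + 1) + 1 := by omega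
    rw [hp]
    conv_rhs => rw [moveAverage, if_neg h, e, avg]
    refine Finset.sum_congr rfl fun y _ => ?_
    congr 1
    rw [moveAverage, List.length_cons, if_neg (by omega)]

lemma nodeLaw_leaf (f g : ℕ → Measure Bool) (m i : ℕ) :
    nodeLaw f g m (0, i) = if i = m then g 0 else f 0 := by
  have : Contains (0, i) m ↔ i = m := by simp [Contains, eq_comm]
  simp [nodeLaw, this]

/-- The linear terms lose exactly one sample per observation, since `S` has drift `±(1 - 2 μ 0)
llrStep μ 0`; the exponential terms are likelihood-ratio martingales. -/
lemma sum_leafPotential (h0 : 0 < (μ 0 : ℝ)) (h1 : (μ 0 : ℝ) < 1 / 2) (i : ℕ) (S : ℝ) :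
    c + ∑ y, (nodeLaw (bernF μ) (bernG μ) m (0, i)).real {y}
        * leafPotential μ n c m E V i (llr (bernF μ) (bernG μ) 0 y + S)
      = leafPotential μ n c m E V i S := by
  have hL := llrStep_pos μ 0 h0 h1
  have hexp := exp_llrStep μ 0 h0 h1
  have hexp' : Real.exp (-llrStep μ 0) = μ 0 / (1 - μ 0) := by
    rw [Real.exp_neg, hexp, inv_div]
  have hx1 : 0 < 1 - (μ 0 : ℝ) := by linarith
  have hd : 0 < 1 - 2 * (μ 0 : ℝ) := by linarith
  rw [Fintype.sum_bool, nodeLaw_leaf, llr_true, llr_false]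
  unfold leafPotential
  split_ifs with hi
  · simp only [neg_add, neg_neg, Real.exp_add, hexp, hexp', bernG_real_true, bernG_real_false]
    generalize (μ 0 : ℝ) = x at *
    generalize llrStep μ 0 = L at *
    generalize Real.exp (-S) = e
    generalize hq : 1 - 2 * x = q at *
    field_simp
    rw [← hq]
    ring
  · simp only [Real.exp_add, hexp, hexp', bernF_real_true, bernF_real_false]
    generalize (μ 0 : ℝ) = x at *
    generalize llrStep μ 0 = L at *
    generalize V (targetDist n m (0, i) - 1) = v
    have e1 : (1 - x) / x * Real.exp S / n = (1 - x) / x * (Real.exp S / n) := by ring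
    have e2 : x / (1 - x) * Real.exp S / n = x / (1 - x) * (Real.exp S / n) := by ring
    rw [e1, e2]
    generalize Real.exp S / n = e
    generalize hq : 1 - 2 * x = q at *
    field_simp
    rw [← hq]
    ring

/-! #### The potential decreases along the walk -/

section Drift

variable {p : ℝ}

lemma IsPotential.nonneg_apply (hV : IsPotential μ K n c p E V) (h0 : 0 < (μ 0 : ℝ))
    (h1 : (μ 0 : ℝ) < 1 / 2) (hn : 1 ≤ n) (hc : 0 < c) (hc1 : c < 1) (d : ℕ) : 0 ≤ V d := by
  refine le_trans ?_ (hV.mono (Nat.zero_le d))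
  have hL := llrStep_pos μ 0 h0 h1
  have hd : 0 < 1 - 2 * (μ 0 : ℝ) := by linarith
  have ht := threshold_pos hn hc hc1
  have := hV.nonneg
  rw [hV.zero]
  positivity

lemma moveAverage_nonneg (hV : ∀ d, 0 ≤ V d) (l i : ℕ) (b : List Bool) :
    0 ≤ moveAverage μ K tie n m V l i b := by
  unfold moveAverage
  split_ifs
  · exact avg_nonneg (fun _ => measureReal_nonneg)
      (fun _ => avg_nonneg (fun _ => measureReal_nonneg) (fun _ => hV _) _ _) _ _
  · exact avg_nonneg (fun _ => measureReal_nonneg) (fun _ => hV _) _ _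

lemma statePotential_nonneg (hV : IsPotential μ K n c p E V) (h0 : 0 < (μ 0 : ℝ))
    (h1 : (μ 0 : ℝ) < 1 / 2) (hn : 1 ≤ n) (hc : 0 < c) (hc1 : c < 1) {s : WalkState}
    (hs : Valid μ K n c s) : 0 ≤ statePotential μ K tie n c m E V s := by
  have hL := llrStep_pos μ 0 h0 h1
  have hd : 0 < 1 - 2 * (μ 0 : ℝ) := by linarith
  have hV0 := hV.nonneg_apply h0 h1 hn hc hc1
  have hE := hV.nonneg
  unfold statePotential
  split_ifs with h2 h3
  · exact le_rfl
  · exact zero_le_one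
  · obtain ⟨⟨_ | l, i⟩, b, d⟩ := s
    · obtain ⟨z, hz, hz'⟩ := (hs.2 h2).1 rfl
      simp only at hz ⊢
      rw [hz]
      unfold leafPotential
      split_ifs
      · have : 0 ≤ threshold n c + llrStep μ 0 - z * llrStep μ 0 := by linarith
        positivity
      · have := hV0 (targetDist n m (0, i) - 1)
        positivity
    · have hb : b.length < 2 * K (l + 1) := (hs.2 h2).2 l rfl
      have hb' : (b.length : ℝ) ≤ 2 * K (l + 1) := by exact_mod_cast hb.le
      have := moveAverage_nonneg (μ := μ) (K := K) (n := n) (m := m) tie hV0 l i b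
      simp only
      exact mul_nonneg hc.le (by linarith)

/-- This is where the detailed potential of a fresh visit is compared with `V`, so that every move
between nodes can be bounded by distance only. -/
lemma statePotential_nil_le (hV : IsPotential μ K n c p E V)
    (hconf : ∀ l, p < confG (bernF μ) (bernG μ) l (K (l + 1)) ∧
      p < confF (bernF μ) (bernG μ) l (K (l + 1)))
    (hn : 1 ≤ n) (hc : 0 < c) (hm : m < 2 ^ n) {v : Node}
    (hv : InTree n v) (hK : ∀ l, 1 ≤ K (l + 1)) {d : Prop} (hd : ¬ d) :
    statePotential μ K tie n c m E V ⟨v, [], d⟩ ≤ c * V (targetDist n m v) := by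
  have hdist := le_targetDist_and_add_le hm hv
  obtain ⟨_ | l, i⟩ := v
  · simp only [statePotential, hd, if_false, sllr, List.map_nil, List.sum_nil, leafPotential]
    split_ifs with hi
    · have : Contains (0, i) m := by simp [Contains, hi]
      rw [targetDist_of_contains this, hV.zero]
      simp
    · have hnc : ¬ Contains (0, i) m := by simpa [Contains, eq_comm] using hi
      have hd1 := targetDist_of_not_contains hm hv hnc
      have hl := hV.leaf (targetDist n m (0, i)) (by omega) (by simpa using hdist.2)
      have hn' : (1 : ℝ) ≤ n := by exact_mod_cast hn
      have hn1 : 1 / (n : ℝ) ≤ 1 := by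
        rw [div_le_one (by linarith)]
        exact hn'
      refine mul_le_mul_of_nonneg_left ?_ hc.le
      simp only [zero_div, zero_add, one_mul, Real.exp_zero]
      linarith
  · simp only at hdist
    have hl := hV.interior l (targetDist n m (l + 1, i)) hdist.1 hdist.2
    have ha := avg_nextNode_le K tie hm hv (hconf l).1 (hconf l).2 hV.mono
    simp only [statePotential, hd, if_false, moveAverage, List.length_nil]
    rw [if_pos (show 0 < K (l + 1) from hK l), Nat.sub_zero]
    refine mul_le_mul_of_nonneg_left ?_ hc.le
    push_cast
    linarith

lemma statePotential_walkStep_leaf_le (hV : IsPotential μ K n c p E V) (h0 : 0 < (μ 0 : ℝ))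
    (h1 : (μ 0 : ℝ) < 1 / 2)
    (hconf : ∀ l, p < confG (bernF μ) (bernG μ) l (K (l + 1)) ∧
      p < confF (bernF μ) (bernG μ) l (K (l + 1)))
    (hn : 1 ≤ n) (hc : 0 < c) (hc1 : c < 1) (hm : m < 2 ^ n) (hK : ∀ l, 1 ≤ K (l + 1))
    {i : ℕ} {b : List Bool} {d : Prop} (hs : Valid μ K n c ⟨(0, i), b, d⟩) (hd : ¬ d) (y : Bool) :
    statePotential μ K tie n c m E V (walkStep (bernF μ) (bernG μ) K tie n c ⟨(0, i), b, d⟩ y)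
      ≤ leafPotential μ n c m E V i
          (llr (bernF μ) (bernG μ) 0 y + sllr (bernF μ) (bernG μ) 0 b) := by
  have hL := llrStep_pos μ 0 h0 h1
  have hdd : 0 < 1 - 2 * (μ 0 : ℝ) := by linarith
  have hV0 := hV.nonneg_apply h0 h1 hn hc hc1
  have hE := hV.nonneg
  have htree : InTree n (0, i) := hs.1
  have hn0 : (0 : ℝ) < n := by exact_mod_cast hn
  obtain ⟨z, hz, hz'⟩ := (hs.2 hd).1 rfl
  simp only at hz
  have hy : llr (bernF μ) (bernG μ) 0 y ≤ llrStep μ 0 := by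
    cases y
    · rw [llr_false]
      linarith
    · rw [llr_true]
  have hthr : Real.log (Real.logb 2 (2 ^ n) / c) = threshold n c := rfl
  simp only [walkStep, hthr, sllr_cons]
  split_ifs with hneg hbig
  · refine (statePotential_nil_le tie hV hconf hn hc hm htree.parent hK hd).trans ?_
    have hS : llr (bernF μ) (bernG μ) 0 y + sllr (bernF μ) (bernG μ) 0 b = -llrStep μ 0 := by
      rw [hz] at hneg ⊢
      cases y with
      | true =>
        rw [llr_true] at hneg
        have : (0 : ℝ) ≤ z * llrStep μ 0 := by positivity
        linarith
      | false =>
        rw [llr_false] at hneg ⊢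
        cases z with
        | zero => simp
        | succ z =>
          have : (0 : ℝ) ≤ z * llrStep μ 0 := by positivity
          push_cast at hneg
          linarith
    rw [hS]
    unfold leafPotential
    rw [← mul_ite]
    refine mul_le_mul_of_nonneg_left ?_ hc.le
    split_ifs with hi
    · have hcon : Contains (0, i) m := by simp [Contains, hi]
      have hp : parent n (0, i) = (1, i / 2) := by
        have : (0 : ℕ) ≠ n := by omega
        simp [parent, this]
      have hcon' : Contains (1, i / 2) m := hcon.succ
      rw [hp, targetDist_of_contains hcon', neg_neg, exp_llrStep μ 0 h0 h1]
      have h2 := hV.one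
      rw [hV.zero] at h2
      -- The linear term at `-llrStep μ 0` already covers the linear part of `V 0`; the exponential
      -- term pays for the rest.
      have h3 : (threshold n c + llrStep μ 0) / ((1 - 2 * (μ 0 : ℝ)) * llrStep μ 0)
          ≤ (threshold n c + llrStep μ 0 - -llrStep μ 0) / ((1 - 2 * (μ 0 : ℝ)) * llrStep μ 0) := by
        gcongr
        linarith
      simp only
      linarith
    · have hnc : ¬ Contains (0, i) m := by simpa [Contains, eq_comm] using hi
      rw [targetDist_of_not_contains hm htree hnc, Nat.add_sub_cancel, neg_div,
        div_self hL.ne', neg_add_cancel, zero_mul, zero_add]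
      have : 0 ≤ Real.exp (-llrStep μ 0) / n := by positivity
      linarith
  · simp only [statePotential, if_true, leafPotential]
    split_ifs with hi
    · have : 0 ≤ threshold n c + llrStep μ 0
          - (llr (bernF μ) (bernG μ) 0 y + sllr (bernF μ) (bernG μ) 0 b) := by
        rw [hz]
        linarith
      positivity
    · rw [not_lt] at hneg
      -- Past the threshold `c exp S / n ≥ 1`, which alone covers the unit loss.
      have h2 : n / c ≤ Real.exp (llr (bernF μ) (bernG μ) 0 y + sllr (bernF μ) (bernG μ) 0 b) := by
        rw [← exp_threshold hn hc]
        exact Real.exp_le_exp.2 hbig.le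
      have h3 : 1 / c ≤
          Real.exp (llr (bernF μ) (bernG μ) 0 y + sllr (bernF μ) (bernG μ) 0 b) / n := by
        rw [le_div_iff₀ hn0]
        calc 1 / c * n = n / c := by ring
          _ ≤ _ := h2
      have h4 := hV0 (targetDist n m (0, i) - 1)
      have h5 : 0 ≤ ((llr (bernF μ) (bernG μ) 0 y + sllr (bernF μ) (bernG μ) 0 b) / llrStep μ 0 + 1)
          * (1 / (1 - 2 * (μ 0 : ℝ))) := by positivity
      calc (1 : ℝ) = c * (1 / c) := by field_simp
        _ ≤ _ := mul_le_mul_of_nonneg_left (by linarith) hc.le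
  · simp only [statePotential, hd, if_false, sllr_cons]
    exact le_rfl

lemma statePotential_walkStep_succ_le (hV : IsPotential μ K n c p E V)
    (hconf : ∀ l, p < confG (bernF μ) (bernG μ) l (K (l + 1)) ∧
      p < confF (bernF μ) (bernG μ) l (K (l + 1)))
    (hn : 1 ≤ n) (hc : 0 < c) (hm : m < 2 ^ n) (hK : ∀ l, 1 ≤ K (l + 1))
    {l i : ℕ} {b : List Bool} {d : Prop} (hs : Valid μ K n c ⟨(l + 1, i), b, d⟩) (hd : ¬ d)
    (y : Bool) :
    statePotential μ K tie n c m E V (walkStep (bernF μ) (bernG μ) K tie n c ⟨(l + 1, i), b, d⟩ y)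
      ≤ c * (2 * K (l + 1) - (b.length + 1) + moveAverage μ K tie n m V l i (y :: b)) := by
  have hb : b.length < 2 * K (l + 1) := (hs.2 hd).2 l rfl
  rw [walkStep_succ]
  split_ifs with h
  · simp only [statePotential, hd, if_false, List.length_cons]
    push_cast
    exact le_rfl
  · refine (statePotential_nil_le tie hV hconf hn hc hm (InTree.nextNode _ _ _ _ hs.1 _) hK
      hd).trans (mul_le_mul_of_nonneg_left ?_ hc.le)
    have e : 2 * K (l + 1) = b.length + 1 := by omega
    have e' : (2 : ℝ) * K (l + 1) = b.length + 1 := by exact_mod_cast e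
    have hlen : ¬ (y :: b).length < K (l + 1) := by
      have := hK l
      simp only [List.length_cons]
      omega
    rw [moveAverage, if_neg hlen, List.length_cons, ← e, Nat.sub_self, avg, e', sub_self, zero_add]

/-- The potential decreases on average by at least `c` with each observation. -/
lemma add_sum_statePotential_le (hV : IsPotential μ K n c p E V) (h0 : 0 < (μ 0 : ℝ))
    (h1 : (μ 0 : ℝ) < 1 / 2)
    (hconf : ∀ l, p < confG (bernF μ) (bernG μ) l (K (l + 1)) ∧
      p < confF (bernF μ) (bernG μ) l (K (l + 1)))
    (hn : 1 ≤ n) (hc : 0 < c) (hc1 : c < 1) (hm : m < 2 ^ n) (hK : ∀ l, 1 ≤ K (l + 1))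
    {s : WalkState} (hs : Valid μ K n c s) (hd : ¬ s.done) :
    c + ∑ y, (nodeLaw (bernF μ) (bernG μ) m (probe K s)).real {y}
        * statePotential μ K tie n c m E V (walkStep (bernF μ) (bernG μ) K tie n c s y)
      ≤ statePotential μ K tie n c m E V s := by
  obtain ⟨⟨_ | l, i⟩, b, d⟩ := s
  · have e : statePotential μ K tie n c m E V ⟨(0, i), b, d⟩
        = leafPotential μ n c m E V i (sllr (bernF μ) (bernG μ) 0 b) := by
      simp only [statePotential, if_neg hd]
    rw [e, ← sum_leafPotential h0 h1]
    refine add_le_add le_rfl (Finset.sum_le_sum fun y _ => ?_)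
    exact mul_le_mul_of_nonneg_left
      (statePotential_walkStep_leaf_le tie hV h0 h1 hconf hn hc hc1 hm hK hs hd y)
      measureReal_nonneg
  · have hb : b.length < 2 * K (l + 1) := (hs.2 hd).2 l rfl
    have e : statePotential μ K tie n c m E V ⟨(l + 1, i), b, d⟩
        = c * (2 * K (l + 1) - b.length + moveAverage μ K tie n m V l i b) := by
      simp only [statePotential, if_neg hd]
    set ν := nodeLaw (bernF μ) (bernG μ) m (probe K ⟨(l + 1, i), b, d⟩) with hν
    have hone : ∑ y, ν.real {y} = 1 := by
      have := sum_measureReal_singleton (μ := ν) (Finset.univ : Finset Bool)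
      rw [this, Finset.coe_univ, probReal_univ]
    rw [e, ← sum_moveAverage tie hb d]
    calc c + ∑ y, ν.real {y} * statePotential μ K tie n c m E V
            (walkStep (bernF μ) (bernG μ) K tie n c ⟨(l + 1, i), b, d⟩ y)
        ≤ c + ∑ y, ν.real {y} *
            (c * (2 * K (l + 1) - (b.length + 1) + moveAverage μ K tie n m V l i (y :: b))) := by
          refine add_le_add le_rfl (Finset.sum_le_sum fun y _ => ?_)
          exact mul_le_mul_of_nonneg_left
            (statePotential_walkStep_succ_le tie hV hconf hn hc hm hK hs hd y) measureReal_nonneg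
      _ = c + c * ((2 * K (l + 1) - (b.length + 1)) * ∑ y, ν.real {y}
            + ∑ y, ν.real {y} * moveAverage μ K tie n m V l i (y :: b)) := by
          rw [Finset.mul_sum, ← Finset.sum_add_distrib, Finset.mul_sum]
          congr 1
          refine Finset.sum_congr rfl fun y _ => ?_
          ring
      _ = c * (2 * K (l + 1) - b.length
            + ∑ y, ν.real {y} * moveAverage μ K tie n m V l i (y :: b)) := by
          rw [hone]
          ring
      _ ≤ _ := le_rfl

/-- The risk of the walk when leaf `m` is the target. -/
lemma irw_error_add_mul_stoppingTime_le (hV : IsPotential μ K n c p E V) (h0 : 0 < (μ 0 : ℝ))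
    (h1 : (μ 0 : ℝ) < 1 / 2)
    (hconf : ∀ l, p < confG (bernF μ) (bernG μ) l (K (l + 1)) ∧
      p < confF (bernF μ) (bernG μ) l (K (l + 1)))
    (hn : 1 ≤ n) (hc : 0 < c) (hc1 : c < 1) (hm : m < 2 ^ n) (hK : ∀ l, 1 ≤ K (l + 1)) :
    obsLaw (bernF μ) (bernG μ) m {ω | ¬ (irw (bernF μ) (bernG μ) K tie n c).Declares m ω}
      + ENNReal.ofReal c * ∫⁻ ω, (irw (bernF μ) (bernG μ) K tie n c).stoppingTime ω
          ∂(obsLaw (bernF μ) (bernG μ) m) ≤ ENNReal.ofReal (c * V n) := by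
  set ws := walkState (bernF μ) (bernG μ) K tie n c with hws
  have hvalid : ∀ h, Valid μ K n c (ws h) := valid_walkState tie h0 h1 hK hn hc hc1
  have hnn : ∀ h, 0 ≤ statePotential μ K tie n c m E V (ws h) :=
    fun h => statePotential_nonneg tie hV h0 h1 hn hc hc1 (hvalid h)
  refine ((irw (bernF μ) (bernG μ) K tie n c).error_add_mul_stoppingTime_le (bernF μ) (bernG μ) m
    (ENNReal.ofReal c) (by simpa using hc)
    (fun h => ENNReal.ofReal (statePotential μ K tie n c m E V (ws h))) ENNReal.ofReal_ne_top
    ?_ ?_).trans ?_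
  · intro h hh hne
    have hh' : (ws h).done := hh
    have hne' : ¬ (ws h).node.2 = m := hne
    simp [statePotential, hh', hne']
  · intro h hh
    have hstep := add_sum_statePotential_le tie hV h0 h1 hconf hn hc hc1 hm hK (hvalid h) hh
    have hnn' : ∀ y ∈ (Finset.univ : Finset Bool),
        0 ≤ (nodeLaw (bernF μ) (bernG μ) m (probe K (ws h))).real {y} *
          statePotential μ K tie n c m E V (walkStep (bernF μ) (bernG μ) K tie n c (ws h) y) :=
      fun y _ => mul_nonneg measureReal_nonneg (hnn (y :: h))
    refine le_trans (le_of_eq ?_) (ENNReal.ofReal_le_ofReal hstep)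
    rw [ENNReal.ofReal_add hc.le (Finset.sum_nonneg hnn'), ENNReal.ofReal_sum_of_nonneg hnn']
    congr 1
    refine Finset.sum_congr rfl fun y _ => ?_
    rw [ENNReal.ofReal_mul measureReal_nonneg, ofReal_measureReal]
    rfl
  · refine ENNReal.ofReal_le_ofReal ?_
    have hroot : Contains (n, 0) m := contains_of_level_eq hm (inTree_root n) rfl
    have := statePotential_nil_le tie hV hconf hn hc hm (inTree_root n) hK
      (d := False) not_false
    rwa [targetDist_of_contains hroot] at this

end Drift

end Potential

/-! ### The risk of the information-directed random walk -/

lemma exists_isPotential {μ : ℕ → unitInterval} {K : ℕ → ℕ} {α p A : ℝ} (hα : 1 < α)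
    (h0 : 0 < (μ 0 : ℝ)) (h1 : (μ 0 : ℝ) < 1 / 2) (hp : 1 / 2 < p) (hp1 : p ≤ 1) (hA : 0 ≤ A)
    (hK : ∀ l : ℕ, (K (l + 1) : ℝ) ≤ A * (α ^ 2) ^ (l + 1)) :
    ∃ B : ℝ, 0 ≤ B ∧ ∀ (n : ℕ) (c : ℝ), ∃ (E : ℝ) (V : ℕ → ℝ), IsPotential μ K n c p E V ∧
      V n ≤ threshold n c / ((1 - 2 * μ 0) * llrStep μ 0) + 1 / (1 - 2 * μ 0)
        + B * (α ^ 2) ^ n := by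
  have hL := llrStep_pos μ 0 h0 h1
  have hd : 0 < 1 - 2 * (μ 0 : ℝ) := by linarith
  have hβ : 1 < α ^ 2 := one_lt_pow₀ hα two_ne_zero
  set C₀ := 1 / (1 - 2 * (μ 0 : ℝ)) with hC₀
  have hC₀' : 0 < C₀ := by positivity
  -- The price covers both the `2 K` samples of a test and the cost `C₀ + 1` of visiting a wrong
  -- leaf.
  obtain ⟨B, hB, hpot⟩ := exists_potential (A := 2 * A + (C₀ + 1)) hp hp1 hβ (by positivity)
  refine ⟨(μ 0 * C₀ + 1) * B, by positivity, fun n c => ?_⟩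
  obtain ⟨W, hW0, hmono, hstep, hW1, hWn⟩ := hpot n
  have hW1' : 0 ≤ W 1 := hW0 ▸ hmono (Nat.zero_le 1)
  -- The solution of `E ((1 - μ 0) / μ 0 - 1) = W 1`, so that the condition `one` holds with
  -- equality.
  set E := μ 0 * C₀ * W 1 with hE
  set V₀ := (threshold n c + llrStep μ 0) / ((1 - 2 * (μ 0 : ℝ)) * llrStep μ 0) + E with hV₀
  have hone : ∀ k : ℕ, 1 ≤ (α ^ 2) ^ k := fun k => one_le_pow₀ hβ.le
  refine ⟨E, fun d => V₀ + W d, ⟨?_, by positivity, ?_, ?_, ?_, ?_⟩, ?_⟩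
  · exact fun a b hab => add_le_add le_rfl (hmono hab)
  · simp only [hW0, add_zero, hV₀]
  · simp only [hW0, add_zero]
    apply add_le_add le_rfl
    have h2 : C₀ * (1 - 2 * μ 0) = 1 := one_div_mul_cancel hd.ne'
    have h3 : (μ 0 : ℝ) * ((1 - μ 0) / μ 0 - 1) = 1 - 2 * μ 0 := by
      rw [mul_sub, mul_div_cancel₀ _ h0.ne']
      ring
    calc W 1 = W 1 * (C₀ * (1 - 2 * μ 0)) := by rw [h2, mul_one]
      _ = E * ((1 - μ 0) / μ 0 - 1) := by rw [← h3, hE]; ring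
      _ ≤ _ := le_rfl
  · intro d hd1 hd2
    have h2 := hstep d hd1 hd2
    have h3 : W (d - 1) ≤ W (d + 1) := hmono (by omega)
    have h4 : (2 * A + (C₀ + 1)) * 1
        ≤ (2 * A + (C₀ + 1)) * (α ^ 2) ^ min d (2 * n - d) :=
      mul_le_mul_of_nonneg_left (hone _) (by positivity)
    have h5 := mul_le_mul_of_nonneg_left h3 (show 0 ≤ 1 - p by linarith)
    linarith
  · intro l d hd1 hd2
    have h2 := hstep d (by omega) (by omega)
    have h3 : (α ^ 2) ^ (l + 1) ≤ (α ^ 2) ^ min d (2 * n - d) :=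
      pow_le_pow_right₀ hβ.le (by omega)
    have h4 := mul_le_mul_of_nonneg_left h3 hA
    have h5 : 0 ≤ (C₀ + 1) * (α ^ 2) ^ min d (2 * n - d) := by positivity
    have h6 := hK l
    linarith
  · have h2 : V₀ = threshold n c / ((1 - 2 * (μ 0 : ℝ)) * llrStep μ 0) + C₀ + E := by
      rw [hV₀, hC₀]
      field_simp
    have h3 : E ≤ μ 0 * C₀ * (B * (α ^ 2) ^ n) := mul_le_mul_of_nonneg_left hW1 (by positivity)
    simp only [h2]
    linarith

lemma bayesRisk_le_of_forall (Γ : Strategy) (f g : ℕ → Measure Bool) {M : ℕ} (π : PMF (Fin M))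
    {c : ℝ} {R : ℝ≥0∞}
    (h : ∀ m < M, obsLaw f g m {ω | ¬ Γ.Declares m ω}
      + ENNReal.ofReal c * ∫⁻ ω, Γ.stoppingTime ω ∂(obsLaw f g m) ≤ R) :
    Γ.bayesRisk f g π c ≤ R := by
  have hsum : ∑ m : Fin M, π m = 1 := by
    rw [← tsum_fintype (L := SummationFilter.unconditional _)]
    exact π.tsum_coe
  rw [Strategy.bayesRisk, Strategy.errorProb, Strategy.sampleComplexity, Finset.mul_sum,
    ← Finset.sum_add_distrib]
  calc ∑ m : Fin M, (π m * obsLaw f g m {ω | ¬ Γ.Declares m ω}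
        + ENNReal.ofReal c * (π m * ∫⁻ ω, Γ.stoppingTime ω ∂(obsLaw f g m)))
      ≤ ∑ m : Fin M, π m * R := by
        refine Finset.sum_le_sum fun m _ => ?_
        rw [mul_left_comm, ← mul_add]
        exact mul_le_mul_right (h m m.2) _
    _ = R := by rw [← Finset.sum_mul, hsum, one_mul]

lemma sampleComplexity_le_of_bayesRisk_le (Γ : Strategy) (f g : ℕ → Measure Bool) {M : ℕ}
    (π : PMF (Fin M)) {c X : ℝ} (hc : 0 < c)
    (h : Γ.bayesRisk f g π c ≤ ENNReal.ofReal (c * X)) :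
    Γ.sampleComplexity f g π ≤ ENNReal.ofReal X := by
  rw [ENNReal.ofReal_mul hc.le] at h
  exact (ENNReal.mul_le_mul_iff_right (by simpa using hc) ENNReal.ofReal_ne_top).1
    (le_add_self.trans h)

lemma two_pow_rpow_logb {β : ℝ} (hβ : 0 < β) (n : ℕ) :
    (((2 ^ n : ℕ) : ℝ)) ^ Real.logb 2 β = β ^ n := by
  push_cast
  rw [← Real.rpow_natCast, ← Real.rpow_mul (by norm_num), mul_comm, Real.rpow_mul (by norm_num),
    Real.rpow_logb (by norm_num) (by norm_num) hβ, Real.rpow_natCast]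

lemma threshold_le {β : ℝ} (hβ : 1 < β) {n : ℕ} (hn : 1 ≤ n) {c : ℝ} (hc : 0 < c) (hc1 : c < 1) :
    threshold n c ≤ (1 / (β - 1) + Real.log (1 / c)) * β ^ n := by
  have hn0 : (0 : ℝ) < n := by exact_mod_cast hn
  have hb : 0 < β - 1 := by linarith
  have hlogc : 0 ≤ Real.log (1 / c) := by
    apply Real.log_nonneg
    rw [le_div_iff₀ hc]
    linarith
  have h1 : threshold n c = Real.log n + Real.log (1 / c) := by
    rw [threshold, logb_two_pow, ← Real.log_mul hn0.ne' (by positivity), mul_one_div]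
  have h2 : Real.log n ≤ n := (Real.log_le_sub_one_of_pos hn0).trans (by linarith)
  -- Bernoulli's inequality for `β = 1 + (β - 1)`.
  have h3 : (n : ℝ) ≤ 1 / (β - 1) * β ^ n := by
    have := one_add_mul_le_pow (a := β - 1) (by linarith) n
    rw [add_sub_cancel] at this
    rw [div_mul_eq_mul_div, le_div_iff₀ hb]
    linarith
  have h4 : Real.log (1 / c) * 1 ≤ Real.log (1 / c) * β ^ n :=
    mul_le_mul_of_nonneg_left (one_le_pow₀ hβ.le) hlogc
  rw [h1]
  linarith

end TreeSearch

/-! ### Assembly of the risk and sample complexity bounds -/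

open TreeSearch in
theorem theorem3 (α : ℝ) (hα : 1 < α) (μ : ℕ → unitInterval)
    (hμ_pos : 0 < (μ 0 : ℝ)) (hμ_lt : (μ 0 : ℝ) < 1 / 2)
    (hμ : ∀ l : ℕ, (μ l : ℝ) = 1 / 2 - (1 / 2 - (μ 0 : ℝ)) * α ^ (-(l : ℤ)))
    (K : ℕ → ℕ)
    (hK : (∃ p ∈ Set.Ioo (1 / 2 : ℝ) 1, K = minimalSize (bernF μ) (bernG μ) p) ∨
      (∃ η ∈ Set.Ioo (1 / Real.sqrt 2) 1, K = chernoffSize μ η)) :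
    -- the local tests have confidence bounded away from `1 / 2` on all levels
    (∃ p > (1 / 2 : ℝ), ∀ l : ℕ,
      p < confG (bernF μ) (bernG μ) l (K (l + 1)) ∧
      p < confF (bernF μ) (bernG μ) l (K (l + 1))) ∧
    -- the bound on the Bayes risk
    (∃ B C : ℝ, ∀ (n M : ℕ), 1 ≤ n → M = 2 ^ n → ∀ c ∈ Set.Ioo (0 : ℝ) 1,
      ∀ (tie : Node → Prop) (π : PMF (Fin M)),
        (irw (bernF μ) (bernG μ) K tie n c).bayesRisk (bernF μ) (bernG μ) π c ≤
          ENNReal.ofReal (c * B * (M : ℝ) ^ Real.logb 2 (α ^ 2)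
            + c * Real.log (Real.logb 2 M / c)
                / (InformationTheory.klDiv (bernG μ 0) (bernF μ 0)).toReal
            + C * c)) ∧
    -- for fixed `c`, the sample complexity is `O(M ^ (log₂ α²))`
    (∀ c ∈ Set.Ioo (0 : ℝ) 1, ∃ A : ℝ, ∀ (n M : ℕ), 1 ≤ n → M = 2 ^ n →
      ∀ (tie : Node → Prop) (π : PMF (Fin M)),
        (irw (bernF μ) (bernG μ) K tie n c).sampleComplexity (bernF μ) (bernG μ) π ≤
          ENNReal.ofReal (A * (M : ℝ) ^ Real.logb 2 (α ^ 2))) ∧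
    -- which is sublinear in `M` if `α < √2`
    (α < Real.sqrt 2 → ∀ c ∈ Set.Ioo (0 : ℝ) 1,
      ∀ (tie : ℕ → Node → Prop) (π : (n : ℕ) → PMF (Fin (2 ^ n))),
        Filter.Tendsto (fun n : ℕ =>
            (irw (bernF μ) (bernG μ) K (tie n) n c).sampleComplexity (bernF μ) (bernG μ) (π n)
              / (2 ^ n : ENNReal))
          Filter.atTop (nhds 0)) := by
  obtain ⟨⟨p, hp, hconf⟩, A, hA, hKA⟩ := exists_conf_and_size_le hα hμ_pos hμ_lt hμ hK
  have hp1 : p ≤ 1 := (hconf 0).1.le.trans (confG_le_one _ _ _ _)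
  -- Without samples both sums are 0 and the strict inequality in `confG` fails.
  have hK1 : ∀ l, 1 ≤ K (l + 1) := by
    intro l
    by_contra h
    have h2 := (hconf l).1
    rw [show K (l + 1) = 0 by omega, confG_zero] at h2
    linarith
  have hL := llrStep_pos μ 0 hμ_pos hμ_lt
  have hd : 0 < 1 - 2 * (μ 0 : ℝ) := by linarith
  have hα2 : 0 < α ^ 2 := by positivity
  have hβ : 1 < α ^ 2 := one_lt_pow₀ hα two_ne_zero
  obtain ⟨B, hB, hpot⟩ := exists_isPotential hα hμ_pos hμ_lt hp hp1 hA hKA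
  set D := (1 - 2 * (μ 0 : ℝ)) * llrStep μ 0 with hD
  have hD0 : 0 < D := by positivity
  have hrisk : ∀ (n : ℕ), 1 ≤ n → ∀ c ∈ Set.Ioo (0 : ℝ) 1, ∀ (tie : Node → Prop)
      (π : PMF (Fin (2 ^ n))),
      (irw (bernF μ) (bernG μ) K tie n c).bayesRisk (bernF μ) (bernG μ) π c ≤
        ENNReal.ofReal (c * (threshold n c / D + 1 / (1 - 2 * (μ 0 : ℝ)) + B * (α ^ 2) ^ n)) := by
    intro n hn c hc tie π
    obtain ⟨E, V, hV, hVn⟩ := hpot n c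
    refine bayesRisk_le_of_forall _ _ _ π fun m hm => ?_
    exact (irw_error_add_mul_stoppingTime_le tie hV hμ_pos hμ_lt hconf hn hc.1 hc.2 hm hK1).trans
      (ENNReal.ofReal_le_ofReal (mul_le_mul_of_nonneg_left hVn hc.1.le))
  have hsample : ∀ c ∈ Set.Ioo (0 : ℝ) 1, ∃ A : ℝ, ∀ n : ℕ, 1 ≤ n →
      ∀ (tie : Node → Prop) (π : PMF (Fin (2 ^ n))),
        (irw (bernF μ) (bernG μ) K tie n c).sampleComplexity (bernF μ) (bernG μ) π ≤
          ENNReal.ofReal (A * (α ^ 2) ^ n) := by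
    intro c hc
    refine ⟨(1 / (α ^ 2 - 1) + Real.log (1 / c)) / D + 1 / (1 - 2 * (μ 0 : ℝ)) + B,
      fun n hn tie π => ?_⟩
    refine (sampleComplexity_le_of_bayesRisk_le _ _ _ π hc.1 (hrisk n hn c hc tie π)).trans
      (ENNReal.ofReal_le_ofReal ?_)
    have h1 : threshold n c / D ≤ (1 / (α ^ 2 - 1) + Real.log (1 / c)) / D * (α ^ 2) ^ n := by
      rw [div_mul_eq_mul_div]
      exact div_le_div_of_nonneg_right (threshold_le hβ hn hc.1 hc.2) hD0.le
    have h2 : 1 / (1 - 2 * (μ 0 : ℝ)) * 1 ≤ 1 / (1 - 2 * (μ 0 : ℝ)) * (α ^ 2) ^ n :=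
      mul_le_mul_of_nonneg_left (one_le_pow₀ hβ.le) (by positivity)
    linarith
  refine ⟨⟨p, hp, hconf⟩, ⟨B, 1 / (1 - 2 * (μ 0 : ℝ)), ?_⟩, ?_, ?_⟩
  · rintro n M hn rfl c hc tie π
    refine (hrisk n hn c hc tie π).trans (le_of_eq ?_)
    rw [two_pow_rpow_logb hα2, toReal_klDiv_bern μ 0 hμ_pos hμ_lt, ← hD, threshold]
    push_cast
    congr 1
    ring
  · intro c hc
    obtain ⟨A', hA'⟩ := hsample c hc
    refine ⟨A', ?_⟩
    rintro n M hn rfl tie π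
    rw [two_pow_rpow_logb hα2]
    exact hA' n hn tie π
  · intro hα_lt c hc tie π
    obtain ⟨A', hA'⟩ := hsample c hc
    have hlt : α ^ 2 / 2 < 1 := by
      rw [div_lt_one (by norm_num)]
      have := pow_lt_pow_left₀ hα_lt (by linarith) two_ne_zero
      rwa [Real.sq_sqrt (by norm_num)] at this
    have hlim : Filter.Tendsto (fun n : ℕ => ENNReal.ofReal (A' * (α ^ 2 / 2) ^ n))
        Filter.atTop (nhds 0) := by
      have := ENNReal.tendsto_ofReal
        ((tendsto_pow_atTop_nhds_zero_of_lt_one (by positivity) hlt).const_mul A')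
      simpa using this
    refine tendsto_of_tendsto_of_tendsto_of_le_of_le' tendsto_const_nhds hlim
      (Filter.Eventually.of_forall fun n => zero_le) ?_
    filter_upwards [Filter.eventually_ge_atTop 1] with n hn
    have h2 : (2 ^ n : ENNReal) = ENNReal.ofReal (2 ^ n) := by
      rw [ENNReal.ofReal_pow (by norm_num), ENNReal.ofReal_ofNat]
    rw [div_pow, ← mul_div_assoc, ENNReal.ofReal_div_of_pos (by positivity), h2]
    exact ENNReal.div_le_div_right (hA' n hn (tie n) (π n)) _
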